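/- Let $\mathcal H$ be a complex Hilbert space with an orthonormal basis $(e_i)_{i\in\Theta}$, where $\Theta$ is a countable (finite or infinite) set with at least two elements, and let $(\omega_i)_{i\in\Theta}$ be strictly positive real numbers with $\sum_{i\in\Theta}\omega_i=1$. Let $\mathcal F(\mathcal H)=\bigoplus_{n\ge 0}\mathcal H^{\otimes n}$ be the full Fock space, with $\mathcal H^{\otimes 0}=\mathbb C\Omega$ and the orthonormal basis $e_I=e_{i_1}\otimes\cdots\otimes e_{i_k}$ indexed by the finite sequences $I=i_1\cdots i_k$ in $\Theta$ ($e_I=\Omega$ for the empty sequence), let $l_i$ be the left creation operator $\eta\mapsto e_i\otimes\eta$, and define $P_\omega(x)=\sum_{i\in\Theta}\omega_i\,l_i^*xl_i$ for $x\in B(\mathcal F(\mathcal H))$. Let $H^\infty=\{x\in B(\mathcal F(\mathcal H)): P_\omega(x)=x\}$ be the noncommutative Poisson boundary, a von Neumann algebra with the usual adjoint and the Choi–Effros product $x\circ y=E(xy)$, where, for a free ultrafilter $\kappa$ on $\mathbb N$, $E(x)=\lim_{n\to\kappa}\frac1n\sum_{k=0}^{n-1}P_\omega^k(x)$ in the weak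 operator topology (the product does not depend on $\kappa$). Let $\mathcal D$ be the algebra of all $x\in B(\mathcal F(\mathcal H))$ that are diagonal with respect to the basis $(e_I)$, that is, $\langle xe_J,e_I\rangle=0$ for $I\ne J$, and put $\mathcal D_\omega=\mathcal D\cap H^\infty$. Then $\mathcal D_\omega$ is a diffuse maximal abelian subalgebra (masa) of $(H^\infty,\circ)$: it is an abelian von Neumann subalgebra of $H^\infty$ (a $\sigma$-weakly closed unital $*$-subalgebra that is commutative under $\circ$), it is maximal among the abelian von Neumann subalgebras of $H^\infty$, it equals its relative commutant $\mathcal D_\omega'\cap H^\infty=\{x\in H^\infty: x\circ d=d\circ x\text{ for all }d\in\mathcal D_\omega\}$, and it has no minimal projection. -/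

import Mathlib

open Filter Topology
open scoped TensorProduct InnerProductSpace

universe u v

noncomputable section

namespace FockBoundary

/-! ### The full Fock space -/

/-- A complex inner product space, bundled with its structure. -/
structure BundledInner : Type (u + 1) where
  carrier : Type u
  [normed : NormedAddCommGroup carrier]
  [inner : InnerProductSpace ℂ carrier]

attribute [instance] BundledInner.normed BundledInner.inner

section Fock

variable (H : Type u) [NormedAddCommGroup H] [InnerProductSpace ℂ H]

/-- The algebraic tensor powers of `H` with their inner products: the zeroth one is the
one-dimensional space `ℂ¹`, and the next one after `T` is `H ⊗ T`. -/
def tensorPow : ℕ → BundledInner.{u}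
  | 0 => ⟨EuclideanSpace ℂ PUnit.{u + 1}⟩
  | n + 1 => ⟨H ⊗[ℂ] (tensorPow n).carrier⟩

/-- The `n`-fold algebraic tensor power of `H`, an inner product space. -/
abbrev TPow (n : ℕ) : Type u := (tensorPow H n).carrier

/-- The `n`-fold Hilbert space tensor power of `H`. -/
abbrev HTPow (n : ℕ) : Type u := UniformSpace.Completion (TPow H n)

/-- The full Fock space over `H`: the Hilbert space direct sum of all tensor powers of `H`. -/
abbrev FullFock : Type u := lp (fun n : ℕ => HTPow H n) 2

variable {H}

/-- The map `t ↦ ξ ⊗ t` between consecutive algebraic tensor powers. -/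
def tmulLeft (ξ : H) (n : ℕ) : TPow H n →L[ℂ] TPow H (n + 1) :=
  TensorProduct.mkL ℂ H (TPow H n) ξ

theorem norm_tmulLeft (ξ : H) (n : ℕ) (t : TPow H n) : ‖tmulLeft ξ n t‖ = ‖ξ‖ * ‖t‖ :=
  TensorProduct.norm_tmul ξ t

/-- The elementary tensor `ξ₁ ⊗ ⋯ ⊗ ξₖ` of a list of vectors. -/
def pureTensor : (L : List H) → TPow H L.length
  | [] => (EuclideanSpace.single PUnit.unit (1 : ℂ) : EuclideanSpace ℂ PUnit.{u + 1})
  | ξ :: L => tmulLeft ξ L.length (pureTensor L)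

/-- The elementary tensor `ξ₁ ⊗ ⋯ ⊗ ξₖ` as a vector of the full Fock space; for the empty list this
is the vacuum vector. -/
def fockTensor (L : List H) : FullFock H :=
  lp.single 2 L.length ((pureTensor L : TPow H L.length) : HTPow H L.length)

/-- The map `t ↦ ξ ⊗ t` between consecutive Hilbert space tensor powers. -/
def tensorLeft (ξ : H) (n : ℕ) : HTPow H n →L[ℂ] HTPow H (n + 1) :=
  (tmulLeft ξ n).completion

theorem tensorLeft_coe (ξ : H) (n : ℕ) (t : TPow H n) :
    tensorLeft ξ n (t : HTPow H n) = ((tmulLeft ξ n t : TPow H (n + 1)) : HTPow H (n + 1)) :=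
  UniformSpace.Completion.map_coe (tmulLeft ξ n).uniformContinuous t

theorem norm_tensorLeft (ξ : H) (n : ℕ) (t : HTPow H n) :
    ‖tensorLeft ξ n t‖ = ‖ξ‖ * ‖t‖ := by
  induction t using UniformSpace.Completion.induction_on with
  | hp => exact isClosed_eq (by fun_prop) (by fun_prop)
  | ih t =>
    rw [tensorLeft_coe, UniformSpace.Completion.norm_coe, UniformSpace.Completion.norm_coe,
      norm_tmulLeft]

/-- The components of `ξ ⊗ η`, where `η` has the components `η n`. -/
def leftCreationFun (ξ : H) (η : ∀ n, HTPow H n) : ∀ n, HTPow H n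
  | 0 => 0
  | n + 1 => tensorLeft ξ n (η n)

theorem leftCreation_bound (ξ : H) (η : FullFock H) (s : Finset ℕ) :
    ∑ n ∈ s, ‖leftCreationFun ξ (fun n => η n) n‖ ^ (2 : ENNReal).toReal ≤
      (‖ξ‖ * ‖η‖) ^ (2 : ENNReal).toReal := by
  have h0 : 0 < (2 : ENNReal).toReal := by norm_num
  have h1 : ∑ n ∈ s, ‖leftCreationFun ξ (fun n => η n) n‖ ^ (2 : ENNReal).toReal ≤
      ∑ n ∈ Finset.range (s.sup id + 1 + 1),
        ‖leftCreationFun ξ (fun n => η n) n‖ ^ (2 : ENNReal).toReal := by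
    refine Finset.sum_le_sum_of_subset_of_nonneg ?_ fun _ _ _ => by positivity
    intro n hn
    have := Finset.le_sup (f := id) hn
    simp only [id, Finset.mem_range] at *
    omega
  refine h1.trans ?_
  rw [Finset.sum_range_succ']
  simp only [leftCreationFun, norm_zero, Real.zero_rpow h0.ne', add_zero, norm_tensorLeft]
  calc _ = ‖ξ‖ ^ (2 : ENNReal).toReal *
        ∑ n ∈ Finset.range (s.sup id + 1), ‖η n‖ ^ (2 : ENNReal).toReal := by
        rw [Finset.mul_sum]
        refine Finset.sum_congr rfl fun n _ => ?_
        rw [Real.mul_rpow (norm_nonneg _) (norm_nonneg _)]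
    _ ≤ _ := by
        rw [Real.mul_rpow (norm_nonneg _) (norm_nonneg _)]
        gcongr
        exact lp.sum_rpow_le_norm_rpow h0 η _

/-- The left creation operator `η ↦ ξ ⊗ η` on the full Fock space. -/
def leftCreation (ξ : H) : FullFock H →L[ℂ] FullFock H :=
  LinearMap.mkContinuous
    { toFun := fun η => ⟨leftCreationFun ξ fun n => η n, memℓp_gen' (leftCreation_bound ξ η)⟩
      map_add' := fun η₁ η₂ => by
        ext n
        cases n with
        | zero => exact (add_zero (0 : HTPow H 0)).symm
        | succ n => exact map_add (tensorLeft ξ n) (η₁ n) (η₂ n)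
      map_smul' := fun c η => by
        ext n
        cases n with
        | zero => exact (smul_zero c).symm
        | succ n => exact map_smul (tensorLeft ξ n) c (η n) } ‖ξ‖
    fun η => lp.norm_le_of_forall_sum_le (by norm_num) (by positivity) (leftCreation_bound ξ η)

theorem leftCreation_apply_zero (ξ : H) (η : FullFock H) : leftCreation ξ η 0 = 0 := rfl

theorem leftCreation_apply_succ (ξ : H) (η : FullFock H) (n : ℕ) :
    leftCreation ξ η (n + 1) = tensorLeft ξ n (η n) := rfl

theorem leftCreation_fockTensor (ξ : H) (L : List H) :
    leftCreation ξ (fockTensor L) = fockTensor (ξ :: L) := by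
  ext n
  cases n with
  | zero =>
    rw [leftCreation_apply_zero]
    exact (lp.single_apply_ne 2 _ _ (by simp)).symm
  | succ n =>
    rw [leftCreation_apply_succ]
    by_cases h : n = L.length
    · subst h
      have h1 : (fockTensor L : FullFock H) L.length =
        ((pureTensor L : TPow H L.length) : HTPow H L.length) := lp.single_apply_self 2 _ _
      have h2 : (fockTensor (ξ :: L) : FullFock H) (L.length + 1) =
        ((pureTensor (ξ :: L) : TPow H (L.length + 1)) : HTPow H (L.length + 1)) :=
        lp.single_apply_self 2 _ _
      rw [h1, h2, tensorLeft_coe]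
      rfl
    · have h1 : (fockTensor L : FullFock H) n = 0 := lp.single_apply_ne 2 _ _ h
      have h2 : (fockTensor (ξ :: L) : FullFock H) (n + 1) = 0 :=
        lp.single_apply_ne 2 _ _ (by simpa using h)
      rw [h1, h2, map_zero]

end Fock

/-! ### Abelian von Neumann subalgebras, masas, minimal projections

Here `M` is a linear space of bounded operators on `K`, closed under adjoints and in the
`σ`-weak topology and containing `1`, that is a von Neumann algebra for the usual adjoint and for a
product `mul`, which need not be the composition of operators. -/

section Subalgebras

variable {K : Type u} [NormedAddCommGroup K] [InnerProductSpace ℂ K] [CompleteSpace K]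

/-- The `σ`-weak topology on the bounded operators: the coarsest one for which all functionals
`x ↦ ∑ₙ ⟪ξₙ, x ηₙ⟫` with square summable sequences `ξ` and `η` are continuous. -/
abbrev sigmaWeak (K : Type u) [NormedAddCommGroup K] [InnerProductSpace ℂ K] :
    TopologicalSpace (K →L[ℂ] K) :=
  TopologicalSpace.induced
    (fun x (p : lp (fun _ : ℕ => K) 2 × lp (fun _ : ℕ => K) 2) =>
      ∑' n, ⟪p.1 n, x (p.2 n)⟫_ℂ) inferInstance

/-- `A` is an abelian von Neumann subalgebra of `(M, mul)`. -/
structure IsAbelianVNSubalgebra (M : Set (K →L[ℂ] K))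
    (mul : (K →L[ℂ] K) → (K →L[ℂ] K) → (K →L[ℂ] K)) (A : Set (K →L[ℂ] K)) : Prop where
  subset : A ⊆ M
  one_mem : 1 ∈ A
  add_mem : ∀ x ∈ A, ∀ y ∈ A, x + y ∈ A
  smul_mem : ∀ (c : ℂ), ∀ x ∈ A, c • x ∈ A
  star_mem : ∀ x ∈ A, star x ∈ A
  mul_mem : ∀ x ∈ A, ∀ y ∈ A, mul x y ∈ A
  mul_comm : ∀ x ∈ A, ∀ y ∈ A, mul x y = mul y x
  isClosed : IsClosed[sigmaWeak K] A

/-- The relative commutant of `A` in `(M, mul)`. -/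
def relativeCommutant (M : Set (K →L[ℂ] K))
    (mul : (K →L[ℂ] K) → (K →L[ℂ] K) → (K →L[ℂ] K)) (A : Set (K →L[ℂ] K)) : Set (K →L[ℂ] K) :=
  {x | x ∈ M ∧ ∀ a ∈ A, mul x a = mul a x}

/-- `A` is a maximal abelian von Neumann subalgebra of `(M, mul)`, and it is its own relative
commutant. -/
structure IsMasa (M : Set (K →L[ℂ] K))
    (mul : (K →L[ℂ] K) → (K →L[ℂ] K) → (K →L[ℂ] K)) (A : Set (K →L[ℂ] K)) : Prop where
  abelian : IsAbelianVNSubalgebra M mul A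
  maximal : ∀ B, IsAbelianVNSubalgebra M mul B → A ⊆ B → B = A
  relativeCommutant_eq : relativeCommutant M mul A = A

/-- `p` is a projection of the algebra `(A, mul)`. -/
def IsProjectionIn (mul : (K →L[ℂ] K) → (K →L[ℂ] K) → (K →L[ℂ] K)) (A : Set (K →L[ℂ] K))
    (p : K →L[ℂ] K) : Prop :=
  p ∈ A ∧ star p = p ∧ mul p p = p

/-- `q` is a minimal projection of the algebra `(A, mul)`: it is not zero, and the only projections
`p ≤ q` of the algebra are `0` and `q`. -/
def IsMinimalProjectionIn (mul : (K →L[ℂ] K) → (K →L[ℂ] K) → (K →L[ℂ] K)) (A : Set (K →L[ℂ] K))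
    (q : K →L[ℂ] K) : Prop :=
  IsProjectionIn mul A q ∧ q ≠ 0 ∧
    ∀ p, IsProjectionIn mul A p → mul p q = p → p = 0 ∨ p = q

/-- The algebra `(A, mul)` is diffuse: it has no minimal projection. -/
def IsDiffuse (mul : (K →L[ℂ] K) → (K →L[ℂ] K) → (K →L[ℂ] K)) (A : Set (K →L[ℂ] K)) : Prop :=
  ∀ q, ¬ IsMinimalProjectionIn mul A q

end Subalgebras

/-! ### The Poisson boundary -/

section Poisson

variable {H : Type u} [NormedAddCommGroup H] [InnerProductSpace ℂ H]
  {Θ : Type v} (e : HilbertBasis Θ ℂ H) (ω : Θ → ℝ)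

/-- The vector `e_I = e_{i₁} ⊗ ⋯ ⊗ e_{iₖ}` for a finite sequence `I = i₁ ⋯ iₖ`. -/
def fockBasis (I : List Θ) : FullFock H :=
  fockTensor (I.map fun i => e i)

/-- The Markov operator `x ↦ ∑ᵢ ωᵢ lᵢ* x lᵢ`, where `lᵢ` is the left creation operator of `e i`. For
summable weights the series converges absolutely in the operator norm. -/
def markov (x : FullFock H →L[ℂ] FullFock H) : FullFock H →L[ℂ] FullFock H :=
  ∑' i, (ω i : ℂ) • (star (leftCreation (e i)) * x * leftCreation (e i))

/-- The underlying set of the Poisson boundary `H^∞`: the fixed points of the Markov operator. -/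
def poissonBoundary : Set (FullFock H →L[ℂ] FullFock H) :=
  {x | markov e ω x = x}

/-- The Cesàro means `(1/n) ∑_{k < n} P^k(x)` of the Markov operator `P`. -/
def cesaro (n : ℕ) (x : FullFock H →L[ℂ] FullFock H) : FullFock H →L[ℂ] FullFock H :=
  (n : ℂ)⁻¹ • ∑ k ∈ Finset.range n, (markov e ω)^[k] x

/-- The projection onto the harmonic operators: the limit along the ultrafilter `κ` of the Cesàro
means in the weak operator topology. -/
def poissonProjection (κ : Ultrafilter ℕ) (x : FullFock H →L[ℂ] FullFock H) :
    FullFock H →L[ℂ] FullFock H :=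
  (limUnder (κ : Filter ℕ) fun n =>
    (ContinuousLinearMapWOT.ofCLM (cesaro e ω n x) : FullFock H →WOT[ℂ] FullFock H)).toCLM

theorem norm_leftCreation_le (ξ : H) : ‖leftCreation ξ‖ ≤ ‖ξ‖ :=
  LinearMap.mkContinuous_norm_le _ (norm_nonneg _) _

theorem norm_markov_term_le (hω : ∀ i, 0 ≤ ω i) (x : FullFock H →L[ℂ] FullFock H) (i : Θ) :
    ‖(ω i : ℂ) • (star (leftCreation (e i)) * x * leftCreation (e i))‖ ≤ ω i * ‖x‖ := by
  have h1 : ‖leftCreation (e i)‖ ≤ 1 := (norm_leftCreation_le _).trans (e.orthonormal.1 i).le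
  rw [norm_smul, Complex.norm_real, Real.norm_of_nonneg (hω i)]
  refine mul_le_mul_of_nonneg_left ?_ (hω i)
  calc _ ≤ ‖star (leftCreation (e i))‖ * ‖x‖ * ‖leftCreation (e i)‖ :=
        (norm_mul_le _ _).trans (by gcongr; exact norm_mul_le _ _)
    _ ≤ 1 * ‖x‖ * 1 := by
        gcongr
        exact (ContinuousLinearMap.adjoint.norm_map (leftCreation (e i))).le.trans h1
    _ = ‖x‖ := by ring

theorem hasSum_markov (hω : ∀ i, 0 ≤ ω i) (hs : Summable ω) (x : FullFock H →L[ℂ] FullFock H) :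
    HasSum (fun i => (ω i : ℂ) • (star (leftCreation (e i)) * x * leftCreation (e i)))
      (markov e ω x) :=
  (Summable.of_norm_bounded (hs.mul_right ‖x‖) (norm_markov_term_le e ω hω x)).hasSum

theorem norm_markov_le (hω : ∀ i, 0 ≤ ω i) (hs : HasSum ω 1) (x : FullFock H →L[ℂ] FullFock H) :
    ‖markov e ω x‖ ≤ ‖x‖ := by
  simpa [markov] using tsum_of_norm_bounded (hs.mul_right ‖x‖) (norm_markov_term_le e ω hω x)

theorem norm_cesaro_le (hω : ∀ i, 0 ≤ ω i) (hs : HasSum ω 1) (n : ℕ)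
    (x : FullFock H →L[ℂ] FullFock H) : ‖cesaro e ω n x‖ ≤ ‖x‖ := by
  have h : ∀ k, ‖(markov e ω)^[k] x‖ ≤ ‖x‖ := by
    intro k
    induction k with
    | zero => exact le_rfl
    | succ k ih =>
      rw [Function.iterate_succ_apply']
      exact (norm_markov_le e ω hω hs _).trans ih
  rcases Nat.eq_zero_or_pos n with rfl | hn
  · simp [cesaro]
  · have hn' : (0 : ℝ) < n := by exact_mod_cast hn
    calc ‖cesaro e ω n x‖ ≤ (n : ℝ)⁻¹ * ∑ k ∈ Finset.range n, ‖(markov e ω)^[k] x‖ := by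
          rw [cesaro, norm_smul, norm_inv, Complex.norm_natCast]
          gcongr
          exact norm_sum_le _ _
      _ ≤ (n : ℝ)⁻¹ * ∑ k ∈ Finset.range n, ‖x‖ := by
          gcongr
          exact h _
      _ = ‖x‖ := by
          rw [Finset.sum_const, Finset.card_range, nsmul_eq_mul]
          field_simp

/-- A bounded sequence of operators converges in the weak operator topology along any
ultrafilter. -/
theorem exists_wot_limit {K : Type u} [NormedAddCommGroup K] [InnerProductSpace ℂ K]
    [CompleteSpace K] (κ : Ultrafilter ℕ) (A : ℕ → K →L[ℂ] K) (C : ℝ) (hA : ∀ n, ‖A n‖ ≤ C) :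
    ∃ T : K →WOT[ℂ] K,
      Tendsto (fun n => (ContinuousLinearMapWOT.ofCLM (A n) : K →WOT[ℂ] K)) κ (𝓝 T) := by
  have hb : ∀ ξ η n, ‖⟪A n ξ, η⟫_ℂ‖ ≤ C * ‖ξ‖ * ‖η‖ := fun ξ η n =>
    (norm_inner_le_norm _ _).trans (by gcongr; exact (A n).le_of_opNorm_le (hA n) ξ)
  have hex : ∀ ξ η, ∃ z : ℂ, ‖z‖ ≤ C * ‖ξ‖ * ‖η‖ ∧
      Tendsto (fun n => ⟪A n ξ, η⟫_ℂ) κ (𝓝 z) := by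
    intro ξ η
    obtain ⟨z, hz, hz'⟩ := (isCompact_closedBall (0 : ℂ) (C * ‖ξ‖ * ‖η‖)).ultrafilter_le_nhds
      (κ.map fun n => ⟪A n ξ, η⟫_ℂ) (by
        rw [le_principal_iff, Ultrafilter.coe_map, mem_map]
        exact Filter.univ_mem' fun n => by simpa using hb ξ η n)
    exact ⟨z, by simpa using hz, hz'⟩
  choose b hb1 hb2 using hex
  let B : K →ₗ⋆[ℂ] K →ₗ[ℂ] ℂ := LinearMap.mk₂'ₛₗ (starRingEnd ℂ) (RingHom.id ℂ) b
    (fun ξ₁ ξ₂ η => tendsto_nhds_unique (hb2 (ξ₁ + ξ₂) η)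
      (by simpa [inner_add_left] using (hb2 ξ₁ η).add (hb2 ξ₂ η)))
    (fun c ξ η => tendsto_nhds_unique (hb2 (c • ξ) η)
      (by simpa [inner_smul_left, mul_comm] using (hb2 ξ η).const_mul ((starRingEnd ℂ) c)))
    (fun ξ η₁ η₂ => tendsto_nhds_unique (hb2 ξ (η₁ + η₂))
      (by simpa [inner_add_right] using (hb2 ξ η₁).add (hb2 ξ η₂)))
    (fun c ξ η => tendsto_nhds_unique (hb2 ξ (c • η))
      (by simpa [inner_smul_right] using (hb2 ξ η).const_mul c))
  refine ⟨.ofCLM (InnerProductSpace.continuousLinearMapOfBilin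
    (B.mkContinuous₂ C fun ξ η => hb1 ξ η)), ?_⟩
  rw [ContinuousLinearMapWOT.tendsto_iff_forall_inner_apply_tendsto]
  intro ξ η
  have h := (Complex.continuous_conj.tendsto _).comp (hb2 ξ η)
  have h2 : ⟪η, (InnerProductSpace.continuousLinearMapOfBilin
    (B.mkContinuous₂ C fun ξ η => hb1 ξ η)) ξ⟫_ℂ = (starRingEnd ℂ) (b ξ η) := by
    rw [← inner_conj_symm, InnerProductSpace.continuousLinearMapOfBilin_apply]
    rfl
  simp only [ContinuousLinearMapWOT.ofCLM_apply]
  rw [h2]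
  refine h.congr fun n => ?_
  simp [inner_conj_symm]

/-- The limit in the definition of the projection onto the harmonic operators exists. -/
theorem tendsto_cesaro (hω : ∀ i, 0 ≤ ω i) (hs : HasSum ω 1) (κ : Ultrafilter ℕ)
    (x : FullFock H →L[ℂ] FullFock H) :
    Tendsto (fun n =>
      (ContinuousLinearMapWOT.ofCLM (cesaro e ω n x) : FullFock H →WOT[ℂ] FullFock H)) κ
      (𝓝 (.ofCLM (poissonProjection e ω κ x))) :=
  tendsto_nhds_limUnder (exists_wot_limit κ _ ‖x‖ fun n => norm_cesaro_le e ω hω hs n x)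

/-- The Choi-Effros product `x ∘ y = E(x y)`, where `E` is the projection onto the harmonic
operators. -/
def choiEffros (κ : Ultrafilter ℕ) (x y : FullFock H →L[ℂ] FullFock H) :
    FullFock H →L[ℂ] FullFock H :=
  poissonProjection e ω κ (x * y)

/-- The operators on the Fock space that are diagonal with respect to the basis `e_I`. -/
def diagonalOps : Set (FullFock H →L[ℂ] FullFock H) :=
  {x | ∀ I J : List Θ, I ≠ J → ⟪fockBasis e I, x (fockBasis e J)⟫_ℂ = 0}

end Poisson

end FockBoundary

end

open FockBoundary

noncomputable section

namespace FockBoundary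

/-! ### The words as an orthonormal basis of the Fock space. -/

section FockBasis

variable {H : Type u} [NormedAddCommGroup H] [InnerProductSpace ℂ H]

/-! In matrix coefficients, harmonicity is an averaging rule: the entry at `(I, J)` is the `ω`-mean
over letters `i` of the entries at `(iI, jJ)` with `j = i`. Words grow on the left, so a pair
branches into its common extensions `(KI, KJ)`, while the endings of both words are frozen. Since
`κ` is free, the Cesàro limit `E` depends only on the entries at long words
(`poissonProjection_congr`).

The projection `suffixProj e L` onto words ending in `L` has diagonal entries that no longer change
under extension once a word is as long as `L`. Its image `cylinder` under `E` is therefore a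
harmonic diagonal operator with the same entries at long words, and Choi-Effros multiplication by it
can be computed with `suffixProj e L` instead. If a harmonic `x` commutes with all cylinders, its
entry at `(I, J)` vanishes unless one word is a suffix of the other. When `J = CI` with `C`
nonempty, the same holds at every extension, and `(KI, KCI)` is comparable only if `K` is a tail of
the periodic word `…CCC`: one `K` per length.

The analytic core is `coeff_eq_zero_of_forall_exists`: if at most one extension of each length
carries a nonzero entry, the entry is at most `ρ ^ k * ‖x‖` for all `k`, where `ρ < 1` bounds all
weights, hence it is zero. So `x` is diagonal, which gives the relative commutant and maximality.
The same decay gives diffuseness: cutting a minimal projection by cylinders leaves at most one word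
of each length with a nonzero diagonal entry, which forces it to vanish. -/

theorem inner_tensorLeft (ξ η : H) (n : ℕ) (s t : HTPow H n) :
    ⟪tensorLeft ξ n s, tensorLeft η n t⟫_ℂ = ⟪ξ, η⟫_ℂ * ⟪s, t⟫_ℂ := by
  induction s, t using UniformSpace.Completion.induction_on₂ with
  | hp => exact isClosed_eq (by fun_prop) (by fun_prop)
  | ih s t =>
    rw [tensorLeft_coe, tensorLeft_coe, UniformSpace.Completion.inner_coe,
      UniformSpace.Completion.inner_coe]
    exact TensorProduct.inner_tmul (𝕜 := ℂ) ξ η s t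

theorem inner_leftCreation (ξ η : H) (f g : FullFock H) :
    ⟪leftCreation ξ f, leftCreation η g⟫_ℂ = ⟪ξ, η⟫_ℂ * ⟪f, g⟫_ℂ := by
  have h1 : HasSum (fun n => ⟪leftCreation ξ f (n + 1), leftCreation η g (n + 1)⟫_ℂ)
      (⟪ξ, η⟫_ℂ * ⟪f, g⟫_ℂ) :=
    ((lp.hasSum_inner f g).mul_left ⟪ξ, η⟫_ℂ).congr_fun fun n =>
      inner_tensorLeft ξ η n (f n) (g n)
  have h2 : ⟪leftCreation ξ f 0, leftCreation η g 0⟫_ℂ = 0 := by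
    rw [leftCreation_apply_zero, inner_zero_left]
  have h3 := h1.zero_add (f := fun n => ⟪leftCreation ξ f n, leftCreation η g n⟫_ℂ)
  rw [h2, zero_add] at h3
  exact (lp.hasSum_inner (leftCreation ξ f) (leftCreation η g)).unique h3

theorem inner_fockTensor_nil_leftCreation (ξ : H) (f : FullFock H) :
    ⟪fockTensor ([] : List H), leftCreation ξ f⟫_ℂ = 0 := by
  rw [fockTensor, lp.inner_single_left]
  exact inner_zero_right _

theorem inner_fockTensor_nil_self :
    ⟪(fockTensor [] : FullFock H), fockTensor []⟫_ℂ = 1 := by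
  rw [fockTensor, lp.inner_single_left]
  have h : (lp.single 2 ([] : List H).length
      ((pureTensor ([] : List H) : TPow H ([] : List H).length) : HTPow H ([] : List H).length) :
        FullFock H) ([] : List H).length = _ := lp.single_apply_self 2 _ _
  rw [h, UniformSpace.Completion.inner_coe]
  change ⟪(EuclideanSpace.single PUnit.unit (1 : ℂ) : EuclideanSpace ℂ PUnit.{u + 1}),
    EuclideanSpace.single PUnit.unit (1 : ℂ)⟫_ℂ = 1
  simp

theorem leftCreation_single (ξ : H) (n : ℕ) (t : TPow H n) :
    leftCreation ξ (lp.single 2 n (t : HTPow H n)) =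
      lp.single 2 (n + 1) ((tmulLeft ξ n t : TPow H (n + 1)) : HTPow H (n + 1)) := by
  ext m
  cases m with
  | zero =>
    rw [leftCreation_apply_zero]
    exact (lp.single_apply_ne 2 _ _ (by simp)).symm
  | succ m =>
    rw [leftCreation_apply_succ]
    by_cases h : m = n
    · subst h
      rw [lp.single_apply_self, lp.single_apply_self, tensorLeft_coe]
    · rw [lp.single_apply_ne 2 _ _ h, lp.single_apply_ne 2 _ _ (by simpa using h), map_zero]

variable {Θ : Type v} (e : HilbertBasis Θ ℂ H)

theorem fockBasis_cons (i : Θ) (I : List Θ) :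
    fockBasis e (i :: I) = leftCreation (e i) (fockBasis e I) :=
  (leftCreation_fockTensor (e i) (I.map fun i => e i)).symm

theorem orthonormal_fockBasis : Orthonormal ℂ (fockBasis e) := by
  classical
  have key : ∀ I J : List Θ, ⟪fockBasis e I, fockBasis e J⟫_ℂ = if I = J then 1 else 0 := by
    intro I
    induction I with
    | nil =>
      intro J
      cases J with
      | nil => simpa [fockBasis] using inner_fockTensor_nil_self
      | cons j J =>
        rw [fockBasis_cons]
        simpa [fockBasis] using inner_fockTensor_nil_leftCreation (e j) (fockBasis e J)
    | cons i I ih =>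
      intro J
      cases J with
      | nil =>
        have h : ⟪fockBasis e [], leftCreation (e i) (fockBasis e I)⟫_ℂ = 0 :=
          inner_fockTensor_nil_leftCreation (e i) (fockBasis e I)
        rw [fockBasis_cons, ← inner_conj_symm, h]
        simp
      | cons j J =>
        rw [fockBasis_cons, fockBasis_cons, inner_leftCreation, ih,
          orthonormal_iff_ite.1 e.orthonormal]
        by_cases h : i = j <;> by_cases h' : I = J <;> simp [h, h']
  exact orthonormal_iff_ite.2 key

/-- The map `ξ ↦ ξ ⊗ t` into the Fock space. -/
def fockTmulRight (n : ℕ) (t : TPow H n) : H →L[ℂ] FullFock H :=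
  (lp.singleContinuousLinearMap ℂ (fun n : ℕ => HTPow H n) 2 (n + 1)).comp
    ((UniformSpace.Completion.toComplL (𝕜 := ℂ) (E := TPow H (n + 1))).comp
      ((TensorProduct.mkL ℂ H (TPow H n)).flip t))

theorem fockTmulRight_apply (n : ℕ) (t : TPow H n) (ξ : H) :
    fockTmulRight n t ξ = leftCreation ξ (lp.single 2 n (t : HTPow H n)) :=
  (leftCreation_single ξ n t).symm

/-- The closed linear span of the vectors `e_I`. -/
def fockSpan : Submodule ℂ (FullFock H) :=
  (Submodule.span ℂ (Set.range (fockBasis e))).topologicalClosure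

theorem fockBasis_mem_fockSpan (I : List Θ) : fockBasis e I ∈ fockSpan e :=
  Submodule.le_topologicalClosure _ (Submodule.subset_span ⟨I, rfl⟩)

/-- A vector `ξ` is only a limit of combinations of the `e i`, so continuity of `ξ ⊗ t` in the left
factor, packaged in `fockTmulRight`, is what is needed. -/
theorem leftCreation_fockBasis_mem (ξ : H) (I : List Θ) :
    leftCreation ξ (fockBasis e I) ∈ fockSpan e := by
  let Φ := fockTmulRight (I.map fun i => e i).length (pureTensor (I.map fun i => e i))
  have h : (Submodule.span ℂ (Set.range e)).topologicalClosure ≤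
      (fockSpan e).comap Φ.toLinearMap := by
    refine Submodule.topologicalClosure_minimal _ (Submodule.span_le.2 ?_)
      ((Submodule.isClosed_topologicalClosure _).preimage Φ.continuous)
    rintro _ ⟨i, rfl⟩
    change Φ (e i) ∈ fockSpan e
    rw [fockTmulRight_apply]
    exact (fockBasis_cons e i I) ▸ fockBasis_mem_fockSpan e (i :: I)
  have h2 := h (e.dense_span ▸ Submodule.mem_top : ξ ∈ _)
  change Φ ξ ∈ fockSpan e at h2
  rwa [fockTmulRight_apply] at h2

theorem leftCreation_mem_fockSpan (ξ : H) {f : FullFock H} (hf : f ∈ fockSpan e) :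
    leftCreation ξ f ∈ fockSpan e := by
  have h : fockSpan e ≤ (fockSpan e).comap (leftCreation ξ).toLinearMap := by
    refine Submodule.topologicalClosure_minimal _ (Submodule.span_le.2 ?_)
      ((Submodule.isClosed_topologicalClosure _).preimage (leftCreation ξ).continuous)
    rintro _ ⟨I, rfl⟩
    exact leftCreation_fockBasis_mem e ξ I
  exact h hf

theorem exists_eq_smul_pureTensor_nil (t : TPow H 0) :
    ∃ c : ℂ, t = c • (pureTensor ([] : List H) : TPow H 0) := by
  have h : ∀ t : EuclideanSpace ℂ PUnit.{u + 1},
      t = t PUnit.unit • EuclideanSpace.single PUnit.unit (1 : ℂ) := by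
    intro t
    ext i
    simp
  exact ⟨_, h t⟩

theorem single_coe_add (n : ℕ) (s t : TPow H n) :
    (lp.single 2 n ((s + t : TPow H n) : HTPow H n) : FullFock H) =
      lp.single 2 n (s : HTPow H n) + lp.single 2 n (t : HTPow H n) := by
  rw [UniformSpace.Completion.coe_add, lp.single_add]

theorem single_coe_mem_fockSpan (n : ℕ) (t : TPow H n) :
    (lp.single 2 n (t : HTPow H n) : FullFock H) ∈ fockSpan e := by
  induction n with
  | zero =>
    obtain ⟨c, rfl⟩ := exists_eq_smul_pureTensor_nil t
    rw [ UniformSpace.Completion.coe_smul, lp.single_smul]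
    exact Submodule.smul_mem _ _ (fockBasis_mem_fockSpan e [])
  | succ n ih =>
    -- Unfolds the recursion defining the tensor powers, so that induction on tensors applies.
    change H ⊗[ℂ] TPow H n at t
    induction t using TensorProduct.induction_on with
    | zero =>
      have h : (lp.single 2 (n + 1) (((0 : TPow H (n + 1)) : TPow H (n + 1)) : HTPow H (n + 1)) :
          FullFock H) = 0 := by
        rw [UniformSpace.Completion.coe_zero, lp.single_zero]
      exact h ▸ Submodule.zero_mem _
    | tmul ξ t => exact leftCreation_single ξ n t ▸ leftCreation_mem_fockSpan e ξ (ih t)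
    | add s t hs ht =>
      exact single_coe_add (n + 1) s t ▸ Submodule.add_mem _ hs ht

theorem fockSpan_eq_top : fockSpan e = ⊤ := by
  have hc : IsClosed (fockSpan e : Set (FullFock H)) := Submodule.isClosed_topologicalClosure _
  have h1 : ∀ (n : ℕ) (t : HTPow H n), (lp.single 2 n t : FullFock H) ∈ fockSpan e := by
    intro n t
    induction t using UniformSpace.Completion.induction_on with
    | hp =>
      exact hc.preimage (lp.singleContinuousLinearMap ℂ (fun n : ℕ => HTPow H n) 2 n).continuous
    | ih t => exact single_coe_mem_fockSpan e n t
  refine eq_top_iff.2 fun f _ => ?_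
  exact hc.mem_of_tendsto (lp.hasSum_single (by simp) f)
    (Eventually.of_forall fun s => Submodule.sum_mem _ fun n _ => h1 n (f n))

/-- The orthonormal basis `e_I` of the Fock space. -/
def fockHilbertBasis : HilbertBasis (List Θ) ℂ (FullFock H) :=
  HilbertBasis.mk (orthonormal_fockBasis e) (fockSpan_eq_top e).ge

theorem fockHilbertBasis_apply (I : List Θ) : fockHilbertBasis e I = fockBasis e I :=
  congrFun (HilbertBasis.coe_mk (orthonormal_fockBasis e) (fockSpan_eq_top e).ge) I

end FockBasis

/-! ### Matrix coefficients, diagonal operators and suffix projections. -/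

section Coefficients

variable {H : Type u} [NormedAddCommGroup H] [InnerProductSpace ℂ H]
  {Θ : Type v} (e : HilbertBasis Θ ℂ H)

/-- The matrix coefficient `⟪e_I, x e_J⟫` as a functional of the operator `x`. -/
def coeff (I J : List Θ) : (FullFock H →L[ℂ] FullFock H) →L[ℂ] ℂ :=
  (innerSL ℂ (fockBasis e I)).comp
    (ContinuousLinearMap.apply ℂ (FullFock H) (fockBasis e J))

theorem coeff_apply (I J : List Θ) (x : FullFock H →L[ℂ] FullFock H) :
    coeff e I J x = ⟪fockBasis e I, x (fockBasis e J)⟫_ℂ := rfl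

theorem norm_fockBasis (I : List Θ) : ‖fockBasis e I‖ = 1 := (orthonormal_fockBasis e).1 I

theorem norm_coeff_le (I J : List Θ) (x : FullFock H →L[ℂ] FullFock H) :
    ‖coeff e I J x‖ ≤ ‖x‖ := by
  have h := (norm_inner_le_norm (𝕜 := ℂ) (fockBasis e I) (x (fockBasis e J))).trans
    (mul_le_mul_of_nonneg_left (x.le_opNorm (fockBasis e J)) (norm_nonneg _))
  simpa only [norm_fockBasis, one_mul, mul_one, ← coeff_apply] using h

theorem eq_of_inner_fockBasis {f g : FullFock H}
    (h : ∀ I, ⟪fockBasis e I, f⟫_ℂ = ⟪fockBasis e I, g⟫_ℂ) : f = g := by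
  apply (fockHilbertBasis e).repr.injective
  ext I
  simpa [HilbertBasis.repr_apply_apply, fockHilbertBasis_apply] using h I

theorem ext_coeff {x y : FullFock H →L[ℂ] FullFock H}
    (h : ∀ I J, coeff e I J x = coeff e I J y) : x = y := by
  have h1 : ∀ J, x (fockBasis e J) = y (fockBasis e J) := fun J =>
    eq_of_inner_fockBasis e fun I => h I J
  refine ContinuousLinearMap.ext_on (s := Set.range (fockBasis e)) ?_ ?_
  · exact Submodule.dense_iff_topologicalClosure_eq_top.2 (fockSpan_eq_top e)
  · rintro _ ⟨J, rfl⟩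
    exact h1 J

theorem coeff_star (I J : List Θ) (x : FullFock H →L[ℂ] FullFock H) :
    coeff e I J (star x) = (starRingEnd ℂ) (coeff e J I x) := by
  rw [coeff_apply, coeff_apply, inner_conj_symm, ContinuousLinearMap.star_eq_adjoint,
    ContinuousLinearMap.adjoint_inner_right]

theorem coeff_one_of_ne {I J : List Θ} (h : I ≠ J) : coeff e I J 1 = 0 :=
  (orthonormal_fockBasis e).2 h

theorem mem_diagonalOps_iff (x : FullFock H →L[ℂ] FullFock H) :
    x ∈ diagonalOps e ↔ ∀ I J, I ≠ J → coeff e I J x = 0 := Iff.rfl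

theorem star_mem_diagonalOps {x : FullFock H →L[ℂ] FullFock H} (hx : x ∈ diagonalOps e) :
    star x ∈ diagonalOps e := by
  rw [mem_diagonalOps_iff]
  intro I J h
  rw [coeff_star, (mem_diagonalOps_iff e x).1 hx J I h.symm, map_zero]

theorem apply_fockBasis_of_mem_diagonalOps {d : FullFock H →L[ℂ] FullFock H}
    (hd : d ∈ diagonalOps e) (J : List Θ) :
    d (fockBasis e J) = coeff e J J d • fockBasis e J := by
  classical
  refine eq_of_inner_fockBasis e fun I => ?_
  rw [inner_smul_right, orthonormal_iff_ite.1 (orthonormal_fockBasis e)]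
  by_cases h : I = J
  · subst h
    simp [coeff_apply]
  · simpa [h] using hd I J h

theorem coeff_mul_of_mem_diagonalOps (x : FullFock H →L[ℂ] FullFock H)
    {d : FullFock H →L[ℂ] FullFock H} (hd : d ∈ diagonalOps e) (I J : List Θ) :
    coeff e I J (x * d) = coeff e J J d * coeff e I J x := by
  rw [coeff_apply, mul_apply_eq_comp, apply_fockBasis_of_mem_diagonalOps e hd,
    map_smul, inner_smul_right, coeff_apply e I J x]

theorem coeff_of_mem_diagonalOps_mul {d : FullFock H →L[ℂ] FullFock H} (hd : d ∈ diagonalOps e)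
    (x : FullFock H →L[ℂ] FullFock H) (I J : List Θ) :
    coeff e I J (d * x) = coeff e I I d * coeff e I J x := by
  have h := coeff_mul_of_mem_diagonalOps e (star x) (star_mem_diagonalOps e hd) J I
  rw [← star_mul, coeff_star, coeff_star, coeff_star, ← map_mul] at h
  exact (starRingEnd ℂ).injective h

theorem mul_mem_diagonalOps {x y : FullFock H →L[ℂ] FullFock H} (hx : x ∈ diagonalOps e)
    (hy : y ∈ diagonalOps e) : x * y ∈ diagonalOps e := by
  rw [mem_diagonalOps_iff]
  intro I J h
  rw [coeff_of_mem_diagonalOps_mul e hx, (mem_diagonalOps_iff e y).1 hy I J h, mul_zero]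

theorem mul_comm_of_mem_diagonalOps {x y : FullFock H →L[ℂ] FullFock H} (hx : x ∈ diagonalOps e)
    (hy : y ∈ diagonalOps e) : x * y = y * x := by
  refine ext_coeff e fun I J => ?_
  rw [coeff_of_mem_diagonalOps_mul e hx, coeff_of_mem_diagonalOps_mul e hy]
  by_cases h : I = J
  · subst h
    exact mul_comm _ _
  · rw [(mem_diagonalOps_iff e x).1 hx I J h, (mem_diagonalOps_iff e y).1 hy I J h, mul_zero,
      mul_zero]

/-- The orthogonal projection onto the closed span of the `e_I` for which `I` ends in `L`. -/
def suffixProj (L : List Θ) : FullFock H →L[ℂ] FullFock H :=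
  (Submodule.span ℂ (fockBasis e '' {I | L <:+ I})).topologicalClosure.starProjection

theorem suffixProj_fockBasis_of_suffix {L I : List Θ} (h : L <:+ I) :
    suffixProj e L (fockBasis e I) = fockBasis e I :=
  Submodule.starProjection_eq_self_iff.2
    (Submodule.le_topologicalClosure _ (Submodule.subset_span ⟨I, h, rfl⟩))

theorem suffixProj_fockBasis_of_not_suffix {L I : List Θ} (h : ¬ L <:+ I) :
    suffixProj e L (fockBasis e I) = 0 := by
  rw [suffixProj, Submodule.starProjection_apply_eq_zero_iff, Submodule.orthogonal_closure,
    Submodule.mem_orthogonal]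
  intro f hf
  induction hf using Submodule.span_induction with
  | mem f hf =>
    obtain ⟨J, hJ, rfl⟩ := hf
    exact (orthonormal_fockBasis e).2 fun hJI => h (hJI ▸ hJ)
  | zero => exact inner_zero_left _
  | add f g _ _ hf hg => rw [inner_add_left, hf, hg, add_zero]
  | smul c f _ hf => rw [inner_smul_left, hf, mul_zero]

theorem suffixProj_mem_diagonalOps (L : List Θ) : suffixProj e L ∈ diagonalOps e := by
  intro I J h
  by_cases hL : L <:+ J
  · rw [suffixProj_fockBasis_of_suffix e hL, (orthonormal_fockBasis e).2 h]
  · rw [suffixProj_fockBasis_of_not_suffix e hL, inner_zero_right]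

theorem coeff_suffixProj_of_suffix {L I : List Θ} (h : L <:+ I) :
    coeff e I I (suffixProj e L) = 1 := by
  rw [coeff_apply, suffixProj_fockBasis_of_suffix e h, inner_self_eq_norm_sq_to_K, norm_fockBasis]
  simp

theorem coeff_suffixProj_of_not_suffix {L I : List Θ} (h : ¬ L <:+ I) :
    coeff e I I (suffixProj e L) = 0 := by
  rw [coeff_apply, suffixProj_fockBasis_of_not_suffix e h, inner_zero_right]

/-- Prepending letters cannot alter the ending of a word already as long as `L`. This makes the
projection harmonic from depth `L.length` on. -/
theorem coeff_suffixProj_append {L I : List Θ} (h : L.length ≤ I.length) (K : List Θ) :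
    coeff e (K ++ I) (K ++ I) (suffixProj e L) = coeff e I I (suffixProj e L) := by
  by_cases hL : L <:+ I
  · rw [coeff_suffixProj_of_suffix e hL,
      coeff_suffixProj_of_suffix e (hL.trans (List.suffix_append K I))]
  · rw [coeff_suffixProj_of_not_suffix e hL, coeff_suffixProj_of_not_suffix e fun h' =>
      hL (List.suffix_of_suffix_length_le h' (List.suffix_append K I) h)]

theorem star_suffixProj (L : List Θ) : star (suffixProj e L) = suffixProj e L := by
  refine ext_coeff e fun I J => ?_
  rw [coeff_star]
  by_cases h : I = J
  · subst h
    by_cases hL : L <:+ I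
    · rw [coeff_suffixProj_of_suffix e hL, map_one]
    · rw [coeff_suffixProj_of_not_suffix e hL, map_zero]
  · have hd := (mem_diagonalOps_iff e _).1 (suffixProj_mem_diagonalOps e L)
    rw [hd I J h, hd J I (Ne.symm h), map_zero]

end Coefficients

/-! ### The Markov operator on coefficients, and the projection onto the harmonic operators. -/

section Harmonic

variable {H : Type u} [NormedAddCommGroup H] [InnerProductSpace ℂ H]
  {Θ : Type v} (e : HilbertBasis Θ ℂ H) {ω : Θ → ℝ}

theorem coeff_markov_term (i : Θ) (x : FullFock H →L[ℂ] FullFock H) (I J : List Θ) :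
    coeff e I J ((ω i : ℂ) • (star (leftCreation (e i)) * x * leftCreation (e i))) =
      ω i * coeff e (i :: I) (i :: J) x := by
  rw [map_smul, smul_eq_mul, coeff_apply, coeff_apply, mul_apply_eq_comp,
    mul_apply_eq_comp, ContinuousLinearMap.star_eq_adjoint,
    ContinuousLinearMap.adjoint_inner_right, fockBasis_cons, fockBasis_cons]

theorem hasSum_coeff_markov (hω : ∀ i, 0 ≤ ω i) (hs : HasSum ω 1) 
    (x : FullFock H →L[ℂ] FullFock H) (I J : List Θ) :
    HasSum (fun i => (ω i : ℂ) * coeff e (i :: I) (i :: J) x) (coeff e I J (markov e ω x)) := by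
  have h := (hasSum_markov e ω hω hs.summable x).mapL (coeff e I J)
  simpa only [coeff_markov_term] using h

end Harmonic

section Harmonic

variable {H : Type u} [NormedAddCommGroup H] [InnerProductSpace ℂ H]
  {Θ : Type v} (e : HilbertBasis Θ ℂ H) {ω : Θ → ℝ}

/-- The Markov operator as a linear map. -/
def markovLinear (hω : ∀ i, 0 ≤ ω i) (hs : HasSum ω 1) :
    (FullFock H →L[ℂ] FullFock H) →ₗ[ℂ] (FullFock H →L[ℂ] FullFock H) where
  toFun := markov e ω
  map_add' x y := ext_coeff e fun I J => by
    refine (hasSum_coeff_markov e hω hs (x + y) I J).unique ?_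
    rw [map_add]
    refine ((hasSum_coeff_markov e hω hs x I J).add
      (hasSum_coeff_markov e hω hs y I J)).congr_fun fun i => ?_
    rw [map_add, mul_add]
  map_smul' c x := ext_coeff e fun I J => by
    refine (hasSum_coeff_markov e hω hs (c • x) I J).unique ?_
    rw [map_smul, RingHom.id_apply, smul_eq_mul]
    refine ((hasSum_coeff_markov e hω hs x I J).mul_left c).congr_fun fun i => ?_
    rw [map_smul, smul_eq_mul, mul_left_comm]

theorem markov_star (hω : ∀ i, 0 ≤ ω i) (hs : HasSum ω 1) (x : FullFock H →L[ℂ] FullFock H) :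
    markov e ω (star x) = star (markov e ω x) := by
  refine ext_coeff e fun I J => ?_
  rw [coeff_star]
  refine (hasSum_coeff_markov e hω hs (star x) I J).unique ?_
  refine ((hasSum_coeff_markov e hω hs x J I).mapL
    Complex.conjCLE.toContinuousLinearMap).congr_fun fun i => ?_
  simp [coeff_star]

theorem iterate_markov_star (hω : ∀ i, 0 ≤ ω i) (hs : HasSum ω 1) (k : ℕ)
    (x : FullFock H →L[ℂ] FullFock H) :
    (markov e ω)^[k] (star x) = star ((markov e ω)^[k] x) := by
  induction k with
  | zero => rfl
  | succ k ih => rw [Function.iterate_succ_apply', ih, markov_star e hω hs,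
      Function.iterate_succ_apply']

theorem norm_iterate_markov_le (hω : ∀ i, 0 ≤ ω i) (hs : HasSum ω 1) (k : ℕ)
    (x : FullFock H →L[ℂ] FullFock H) : ‖(markov e ω)^[k] x‖ ≤ ‖x‖ := by
  induction k with
  | zero => exact le_rfl
  | succ k ih =>
    rw [Function.iterate_succ_apply']
    exact (norm_markov_le e ω hω hs _).trans ih

theorem one_mem_poissonBoundary (hω : ∀ i, 0 ≤ ω i) (hs : HasSum ω 1) :
    1 ∈ poissonBoundary e ω := by
  classical
  refine ext_coeff e fun I J => (hasSum_coeff_markov e hω hs 1 I J).unique ?_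
  have h : ∀ i, coeff e (i :: I) (i :: J) 1 = coeff e I J 1 := by
    intro i
    have h1 : ∀ I J, coeff e I J 1 = if I = J then 1 else 0 := fun I J =>
      orthonormal_iff_ite.1 (orthonormal_fockBasis e) I J
    rw [h1, h1]
    simp
  simp only [h]
  simpa using (Complex.hasSum_ofReal.2 hs).mul_right (coeff e I J 1)

theorem mem_poissonBoundary_iff_hasSum (hω : ∀ i, 0 ≤ ω i) (hs : HasSum ω 1)
    (x : FullFock H →L[ℂ] FullFock H) :
    x ∈ poissonBoundary e ω ↔ ∀ I J,
      HasSum (fun i => (ω i : ℂ) * coeff e (i :: I) (i :: J) x) (coeff e I J x) := by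
  constructor
  · intro h I J
    have h1 := hasSum_coeff_markov e hω hs x I J
    rwa [show markov e ω x = x from h] at h1
  · exact fun h => ext_coeff e fun I J => (hasSum_coeff_markov e hω hs x I J).unique (h I J)

/-- If the coefficients of `z` are `c` times those of `y` at all long enough extensions of a pair of
words, then so are the coefficients at this pair of the iterates under the Markov operator. -/
theorem coeff_iterate_markov_of_append (hω : ∀ i, 0 ≤ ω i) (hs : HasSum ω 1)
    {y z : FullFock H →L[ℂ] FullFock H} {c : ℂ} {m k : ℕ} (hmk : m ≤ k) {I J : List Θ}
    (h : ∀ K : List Θ, m ≤ K.length →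
      coeff e (K ++ I) (K ++ J) z = c * coeff e (K ++ I) (K ++ J) y) :
    coeff e I J ((markov e ω)^[k] z) = c * coeff e I J ((markov e ω)^[k] y) := by
  induction k generalizing m I J with
  | zero => exact h [] (by simpa using hmk)
  | succ k ih =>
    rw [Function.iterate_succ_apply', Function.iterate_succ_apply']
    refine (hasSum_coeff_markov e hω hs _ I J).unique ?_
    refine ((hasSum_coeff_markov e hω hs ((markov e ω)^[k] y) I J).mul_left c).congr_fun
      fun i => ?_
    -- The letter `i` already supplies one of the `m` required letters; truncated subtraction also
    -- covers `m = 0`.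
    rw [ih (m := m - 1) (by omega) fun K hK => ?_, mul_left_comm]
    simpa using h (K ++ [i]) (by simp only [List.length_append, List.length_singleton]; omega)

theorem coeff_cesaro (n : ℕ) (x : FullFock H →L[ℂ] FullFock H) (I J : List Θ) :
    coeff e I J (cesaro e ω n x) =
      (n : ℂ)⁻¹ * ∑ k ∈ Finset.range n, coeff e I J ((markov e ω)^[k] x) := by
  rw [cesaro, map_smul, map_sum, smul_eq_mul]

theorem tendsto_coeff_cesaro (hω : ∀ i, 0 ≤ ω i) (hs : HasSum ω 1) (κ : Ultrafilter ℕ)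
    (x : FullFock H →L[ℂ] FullFock H) (I J : List Θ) :
    Tendsto (fun n => coeff e I J (cesaro e ω n x)) κ
      (𝓝 (coeff e I J (poissonProjection e ω κ x))) :=
  (ContinuousLinearMapWOT.tendsto_iff_forall_inner_apply_tendsto.1
    (tendsto_cesaro e ω hω hs κ x)) _ _

theorem ultrafilter_le_atTop {κ : Ultrafilter ℕ} (hκ : (κ : Filter ℕ) ≤ cofinite) :
    (κ : Filter ℕ) ≤ atTop :=
  hκ.trans Nat.cofinite_eq_atTop.le

/-- From the iterate `k = m` on the two sides agree, and Cesàro limits along a free ultrafilter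
ignore finitely many iterates. -/
theorem coeff_poissonProjection_of_append (hω : ∀ i, 0 ≤ ω i) (hs : HasSum ω 1)
    {κ : Ultrafilter ℕ} (hκ : (κ : Filter ℕ) ≤ cofinite)
    {y z : FullFock H →L[ℂ] FullFock H} {c : ℂ} (m : ℕ) {I J : List Θ}
    (h : ∀ K : List Θ, m ≤ K.length →
      coeff e (K ++ I) (K ++ J) z = c * coeff e (K ++ I) (K ++ J) y) :
    coeff e I J (poissonProjection e ω κ z) = c * coeff e I J (poissonProjection e ω κ y) := by
  have h1 : Tendsto (fun k => coeff e I J ((markov e ω)^[k] z) -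
      c * coeff e I J ((markov e ω)^[k] y)) atTop (𝓝 0) := by
    refine tendsto_const_nhds.congr' ?_
    filter_upwards [eventually_ge_atTop m] with k hk
    rw [coeff_iterate_markov_of_append e hω hs hk h, sub_self]
  have h2 := h1.cesaro_smul.mono_left (ultrafilter_le_atTop hκ)
  have h3 := (tendsto_coeff_cesaro e hω hs κ z I J).sub
    ((tendsto_coeff_cesaro e hω hs κ y I J).const_mul c)
  refine sub_eq_zero.1 (tendsto_nhds_unique h3 (h2.congr fun n => ?_))
  rw [coeff_cesaro, coeff_cesaro, Finset.sum_sub_distrib, ← Finset.mul_sum, Complex.real_smul]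
  push_cast
  ring

theorem poissonProjection_congr (hω : ∀ i, 0 ≤ ω i) (hs : HasSum ω 1)
    {κ : Ultrafilter ℕ} (hκ : (κ : Filter ℕ) ≤ cofinite)
    {y z : FullFock H →L[ℂ] FullFock H} (m : ℕ)
    (h : ∀ I J : List Θ, m ≤ I.length → m ≤ J.length → coeff e I J z = coeff e I J y) :
    poissonProjection e ω κ z = poissonProjection e ω κ y := by
  refine ext_coeff e fun I J => ?_
  rw [coeff_poissonProjection_of_append e hω hs hκ (c := 1) (y := y) m fun K hK => ?_, one_mul]
  rw [one_mul]
  exact h _ _ (by simp only [List.length_append]; omega) (by simp only [List.length_append]; omega)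

theorem poissonProjection_eq_self (hω : ∀ i, 0 ≤ ω i) (hs : HasSum ω 1)
    {κ : Ultrafilter ℕ} (hκ : (κ : Filter ℕ) ≤ cofinite)
    {x : FullFock H →L[ℂ] FullFock H} (hx : x ∈ poissonBoundary e ω) :
    poissonProjection e ω κ x = x := by
  refine ext_coeff e fun I J => tendsto_nhds_unique (tendsto_coeff_cesaro e hω hs κ x I J) ?_
  have hk : ∀ k, (markov e ω)^[k] x = x := fun k => Function.iterate_fixed hx k
  refine tendsto_const_nhds.congr' ?_
  -- The empty mean `n = 0` is zero, not `x`, and must be discarded.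
  filter_upwards [ultrafilter_le_atTop hκ (eventually_gt_atTop 0)] with n hn
  have hn' : (n : ℂ) ≠ 0 := by exact_mod_cast hn.ne'
  rw [coeff_cesaro]
  simp only [hk, Finset.sum_const, Finset.card_range, nsmul_eq_mul]
  rw [inv_mul_cancel_left₀ hn']

theorem markov_cesaro (hω : ∀ i, 0 ≤ ω i) (hs : HasSum ω 1) (n : ℕ)
    (x : FullFock H →L[ℂ] FullFock H) :
    markov e ω (cesaro e ω n x) =
      cesaro e ω n x + (n : ℂ)⁻¹ • ((markov e ω)^[n] x - x) := by
  change markovLinear e hω hs (cesaro e ω n x) = _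
  rw [cesaro, map_smul, map_sum, ← smul_add]
  congr 1
  have h : ∀ k, markovLinear e hω hs ((markov e ω)^[k] x) = (markov e ω)^[k + 1] x := fun k =>
    (Function.iterate_succ_apply' _ _ _).symm
  simp only [h]
  rw [← sub_eq_iff_eq_add', ← Finset.sum_sub_distrib,
    Finset.sum_range_sub (fun k => (markov e ω)^[k] x)]
  rfl

/-- By telescoping, the Markov operator moves the `n`-th Cesàro mean by at most `2‖x‖ / n`. Weak
limits pass through the possibly infinite Markov sum by dominated convergence, with bound `ω i *
‖x‖`. -/
theorem poissonProjection_mem (hω : ∀ i, 0 ≤ ω i) (hs : HasSum ω 1)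
    {κ : Ultrafilter ℕ} (hκ : (κ : Filter ℕ) ≤ cofinite) (x : FullFock H →L[ℂ] FullFock H) :
    poissonProjection e ω κ x ∈ poissonBoundary e ω := by
  refine ext_coeff e fun I J => ?_
  have h1 : Tendsto (fun n => coeff e I J (markov e ω (cesaro e ω n x))) κ
      (𝓝 (coeff e I J (markov e ω (poissonProjection e ω κ x)))) := by
    simp only [← (hasSum_coeff_markov e hω hs _ I J).tsum_eq]
    refine tendsto_tsum_of_dominated_convergence (hs.summable.mul_right ‖x‖)
      (fun i => (tendsto_coeff_cesaro e hω hs κ x (i :: I) (i :: J)).const_mul _)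
      (Eventually.of_forall fun n i => ?_)
    rw [norm_mul, Complex.norm_real, Real.norm_of_nonneg (hω i)]
    exact mul_le_mul_of_nonneg_left
      ((norm_coeff_le e _ _ _).trans (norm_cesaro_le e ω hω hs n x)) (hω i)
  have h2 : Tendsto (fun n : ℕ => (n : ℂ)⁻¹ * coeff e I J ((markov e ω)^[n] x - x)) κ (𝓝 0) := by
    refine Tendsto.mono_left ?_ (ultrafilter_le_atTop hκ)
    refine Tendsto.zero_mul_isBoundedUnder_le tendsto_inv_atTop_nhds_zero_nat ?_
    refine isBoundedUnder_of ⟨‖x‖ + ‖x‖, fun n => ?_⟩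
    exact (norm_coeff_le e _ _ _).trans ((norm_sub_le _ _).trans
      (add_le_add_left (norm_iterate_markov_le e hω hs n x) _))
  refine tendsto_nhds_unique h1 ?_
  have h3 := (tendsto_coeff_cesaro e hω hs κ x I J).add h2
  rw [add_zero] at h3
  refine h3.congr fun n => ?_
  rw [markov_cesaro e hω hs, map_add, map_smul, smul_eq_mul]

theorem poissonProjection_star (hω : ∀ i, 0 ≤ ω i) (hs : HasSum ω 1) (κ : Ultrafilter ℕ)
    (x : FullFock H →L[ℂ] FullFock H) :
    poissonProjection e ω κ (star x) = star (poissonProjection e ω κ x) := by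
  refine ext_coeff e fun I J => ?_
  refine tendsto_nhds_unique (tendsto_coeff_cesaro e hω hs κ (star x) I J) ?_
  rw [coeff_star]
  refine ((Complex.continuous_conj.tendsto _).comp
    (tendsto_coeff_cesaro e hω hs κ x J I)).congr fun n => ?_
  simp only [Function.comp_apply, coeff_cesaro, iterate_markov_star e hω hs, coeff_star, map_mul,
    map_inv₀, map_sum, map_natCast]

theorem poissonProjection_mem_diagonalOps (hω : ∀ i, 0 ≤ ω i) (hs : HasSum ω 1)
    {κ : Ultrafilter ℕ} (hκ : (κ : Filter ℕ) ≤ cofinite) {x : FullFock H →L[ℂ] FullFock H}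
    (hx : x ∈ diagonalOps e) : poissonProjection e ω κ x ∈ diagonalOps e := by
  rw [mem_diagonalOps_iff]
  intro I J h
  rw [coeff_poissonProjection_of_append e hω hs hκ (c := 0) (y := x) 0 fun K _ => ?_, zero_mul]
  rw [(mem_diagonalOps_iff e x).1 hx _ _ fun h' => h (List.append_cancel_left h'), zero_mul]

end Harmonic

/-! ### Periodic words and a uniform bound on the weights. -/

/-- The suffix condition makes `K` a tail of the left-infinite word `…CCC`, which has one tail of
each length. The induction strips a copy of `C` from the right. -/
theorem _root_.List.eq_of_suffix_append {α : Type*} {C : List α} (hC : C ≠ []) {K K' : List α}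
    (hlen : K.length = K'.length) (hK : K <:+ K ++ C) (hK' : K' <:+ K' ++ C) : K = K' := by
  induction hn : K.length using Nat.strong_induction_on generalizing K K' with
  | _ n ih =>
    have hC0 : 0 < C.length := List.length_pos_iff.2 hC
    rcases le_or_gt n C.length with h | h
    · have h1 : K <:+ C :=
        List.suffix_of_suffix_length_le hK (List.suffix_append K C) (by omega)
      have h2 : K' <:+ C :=
        List.suffix_of_suffix_length_le hK' (List.suffix_append K' C) (by omega)
      exact (List.suffix_of_suffix_length_le h1 h2 hlen.le).eq_of_length hlen
    · obtain ⟨M, rfl⟩ : C <:+ K :=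
        List.suffix_of_suffix_length_le (List.suffix_append K C) hK (by omega)
      obtain ⟨M', rfl⟩ : C <:+ K' :=
        List.suffix_of_suffix_length_le (List.suffix_append K' C) hK' (by omega)
      simp only [List.length_append] at hlen hn
      obtain ⟨D, hD⟩ := hK
      obtain ⟨D', hD'⟩ := hK'
      rw [← List.append_assoc] at hD hD'
      rw [ih M.length (by omega) (by omega) ⟨D, List.append_cancel_right hD⟩
        ⟨D', List.append_cancel_right hD'⟩ rfl]

/-- Two distinct weights sum to at most `1`, and every letter differs from one of two fixed letters
`a`, `b`; hence `1 - min (ω a) (ω b)` works even for infinite `Θ`. -/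
theorem exists_lt_one_forall_le {Θ : Type v} [Nontrivial Θ] {ω : Θ → ℝ} (hpos : ∀ i, 0 < ω i)
    (hs : HasSum ω 1) : ∃ ρ : ℝ, 0 ≤ ρ ∧ ρ < 1 ∧ ∀ i, ω i ≤ ρ := by
  classical
  obtain ⟨a, b, hab⟩ := exists_pair_ne Θ
  have h2 : ∀ i j, i ≠ j → ω i + ω j ≤ 1 := fun i j hij => by
    simpa [Finset.sum_pair hij] using
      sum_le_hasSum {i, j} (fun k _ => (hpos k).le) hs
  have hle : ∀ i, ω i ≤ 1 - min (ω a) (ω b) := by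
    intro i
    by_cases hi : i = a
    · subst hi
      have := h2 i b hab
      have := min_le_right (ω i) (ω b)
      linarith
    · have := h2 i a hi
      have := min_le_left (ω a) (ω b)
      linarith
  exact ⟨1 - min (ω a) (ω b), (hpos a).le.trans (hle a), by
    have := lt_min (hpos a) (hpos b)
    linarith, hle⟩

/-! ### Decay of coefficients, cylinders, and operators commuting with them. -/

section Masa

variable {H : Type u} [NormedAddCommGroup H] [InnerProductSpace ℂ H]
  {Θ : Type v} (e : HilbertBasis Θ ℂ H) {ω : Θ → ℝ}

theorem coeff_eq_zero_of_append (hω : ∀ i, 0 ≤ ω i) (hs : HasSum ω 1)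
    {x : FullFock H →L[ℂ] FullFock H} (hx : x ∈ poissonBoundary e ω) (k : ℕ) {I J : List Θ}
    (h : ∀ K : List Θ, K.length = k → coeff e (K ++ I) (K ++ J) x = 0) : coeff e I J x = 0 := by
  induction k generalizing I J with
  | zero => exact h [] rfl
  | succ k ih =>
    refine ((mem_poissonBoundary_iff_hasSum e hω hs x).1 hx I J).unique
      (hasSum_zero.congr_fun fun i => ?_)
    rw [ih fun K hK => ?_, mul_zero]
    simpa using h (K ++ [i]) (by simp [hK])

/-- Only the branch towards `K₀` survives the averaging, so each of its letters contributes a single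
factor `ω i ≤ ρ`. -/
theorem norm_coeff_le_pow (hω : ∀ i, 0 ≤ ω i) (hs : HasSum ω 1) {ρ : ℝ} (hρ : ∀ i, ω i ≤ ρ)
    {x : FullFock H →L[ℂ] FullFock H} (hx : x ∈ poissonBoundary e ω) {I J K₀ : List Θ}
    (h : ∀ K : List Θ, K.length = K₀.length → K ≠ K₀ → coeff e (K ++ I) (K ++ J) x = 0) :
    ‖coeff e I J x‖ ≤ ρ ^ K₀.length * ‖x‖ := by
  -- Averaging prepends the letter next to `I` first, and that is the last letter of `K₀`.
  induction K₀ using List.reverseRecOn generalizing I J with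
  | nil => simpa using norm_coeff_le e I J x
  | append_singleton K₀ i₀ ih =>
    have h1 : ∀ i, i ≠ i₀ → (ω i : ℂ) * coeff e (i :: I) (i :: J) x = 0 := by
      intro i hi
      rw [coeff_eq_zero_of_append e hω hs hx K₀.length fun K hK => ?_, mul_zero]
      simpa using h (K ++ [i]) (by simp [hK]) fun h' => hi (by simpa using congrArg List.getLast? h')
    rw [((mem_poissonBoundary_iff_hasSum e hω hs x).1 hx I J).unique (hasSum_single i₀ h1),
      norm_mul, Complex.norm_real, Real.norm_of_nonneg (hω i₀), List.length_append,
      List.length_singleton, pow_succ', mul_assoc]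
    refine mul_le_mul (hρ i₀) (ih fun K hK hne => ?_) (norm_nonneg _) ((hω i₀).trans (hρ i₀))
    simpa using h (K ++ [i₀]) (by simp [hK]) fun h' => hne (List.append_cancel_right h')

/-- A coefficient of a harmonic operator is zero if, at every depth, at most one extension of its
pair of words has a nonzero coefficient. -/
theorem coeff_eq_zero_of_forall_exists [Nontrivial Θ] (hpos : ∀ i, 0 < ω i) (hs : HasSum ω 1)
    {x : FullFock H →L[ℂ] FullFock H} (hx : x ∈ poissonBoundary e ω) {I J : List Θ}
    (h : ∀ K K' : List Θ, K.length = K'.length → coeff e (K ++ I) (K ++ J) x ≠ 0 →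
      coeff e (K' ++ I) (K' ++ J) x ≠ 0 → K = K') : coeff e I J x = 0 := by
  obtain ⟨ρ, hρ0, hρ1, hρ⟩ := exists_lt_one_forall_le hpos hs
  by_contra hne
  have hω : ∀ i, 0 ≤ ω i := fun i => (hpos i).le
  have hb : ∀ k, ‖coeff e I J x‖ ≤ ρ ^ k * ‖x‖ := by
    intro k
    -- A nonzero entry must have a nonzero extension at every depth; by hypothesis it is the only
    -- one there.
    obtain ⟨K₀, hK₀, hK₀'⟩ : ∃ K₀ : List Θ, K₀.length = k ∧
        coeff e (K₀ ++ I) (K₀ ++ J) x ≠ 0 := by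
      by_contra! h'
      exact hne (coeff_eq_zero_of_append e hω hs hx k h')
    subst hK₀
    refine norm_coeff_le_pow e hω hs hρ hx fun K hK hKne => ?_
    by_contra h'
    exact hKne (h K K₀ hK h' hK₀')
  have ht : Tendsto (fun k : ℕ => ρ ^ k * ‖x‖) atTop (𝓝 0) := by
    simpa using (tendsto_pow_atTop_nhds_zero_of_lt_one hρ0 hρ1).mul_const ‖x‖
  exact hne (norm_le_zero_iff.1 (ge_of_tendsto' ht hb))

/-- The harmonic operator with the same boundary values as the projection onto the words that end
in `L`. -/
def cylinder (ω : Θ → ℝ) (κ : Ultrafilter ℕ) (L : List Θ) : FullFock H →L[ℂ] FullFock H :=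
  poissonProjection e ω κ (suffixProj e L)

theorem cylinder_mem (hω : ∀ i, 0 ≤ ω i) (hs : HasSum ω 1) {κ : Ultrafilter ℕ}
    (hκ : (κ : Filter ℕ) ≤ cofinite) (L : List Θ) :
    cylinder e ω κ L ∈ diagonalOps e ∩ poissonBoundary e ω :=
  ⟨poissonProjection_mem_diagonalOps e hω hs hκ (suffixProj_mem_diagonalOps e L),
    poissonProjection_mem e hω hs hκ _⟩

theorem coeff_poissonProjection_suffixProj_mul (hω : ∀ i, 0 ≤ ω i) (hs : HasSum ω 1)
    {κ : Ultrafilter ℕ} (hκ : (κ : Filter ℕ) ≤ cofinite) {L I : List Θ}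
    (h : L.length ≤ I.length) (J : List Θ) (y : FullFock H →L[ℂ] FullFock H) :
    coeff e I J (poissonProjection e ω κ (suffixProj e L * y)) =
      coeff e I I (suffixProj e L) * coeff e I J (poissonProjection e ω κ y) := by
  refine coeff_poissonProjection_of_append e hω hs hκ 0 fun K _ => ?_
  rw [coeff_of_mem_diagonalOps_mul e (suffixProj_mem_diagonalOps e L), coeff_suffixProj_append e h]

theorem coeff_cylinder (hω : ∀ i, 0 ≤ ω i) (hs : HasSum ω 1) {κ : Ultrafilter ℕ}
    (hκ : (κ : Filter ℕ) ≤ cofinite) {L I : List Θ} (h : L.length ≤ I.length) :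
    coeff e I I (cylinder e ω κ L) = coeff e I I (suffixProj e L) := by
  have h1 := coeff_poissonProjection_suffixProj_mul e hω hs hκ h I 1
  have h2 : coeff e I I 1 = 1 := by
    simp [coeff_apply, norm_fockBasis]
  rwa [mul_one, poissonProjection_eq_self e hω hs hκ (one_mem_poissonBoundary e hω hs), h2,
    mul_one] at h1

/-- The cylinder and the suffix projection have equal entries at words of length at least
`L.length`, and `E` sees nothing else. -/
theorem choiEffros_cylinder_left (hω : ∀ i, 0 ≤ ω i) (hs : HasSum ω 1) {κ : Ultrafilter ℕ}
    (hκ : (κ : Filter ℕ) ≤ cofinite) (L : List Θ) (y : FullFock H →L[ℂ] FullFock H) :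
    choiEffros e ω κ (cylinder e ω κ L) y = poissonProjection e ω κ (suffixProj e L * y) := by
  refine poissonProjection_congr e hω hs hκ L.length fun I J hI _ => ?_
  rw [coeff_of_mem_diagonalOps_mul e (cylinder_mem e hω hs hκ L).1,
    coeff_of_mem_diagonalOps_mul e (suffixProj_mem_diagonalOps e L), coeff_cylinder e hω hs hκ hI]

theorem choiEffros_cylinder_right (hω : ∀ i, 0 ≤ ω i) (hs : HasSum ω 1) {κ : Ultrafilter ℕ}
    (hκ : (κ : Filter ℕ) ≤ cofinite) (L : List Θ) (y : FullFock H →L[ℂ] FullFock H) :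
    choiEffros e ω κ y (cylinder e ω κ L) = poissonProjection e ω κ (y * suffixProj e L) := by
  refine poissonProjection_congr e hω hs hκ L.length fun I J _ hJ => ?_
  rw [coeff_mul_of_mem_diagonalOps e y (cylinder_mem e hω hs hκ L).1,
    coeff_mul_of_mem_diagonalOps e y (suffixProj_mem_diagonalOps e L), coeff_cylinder e hω hs hκ hJ]

/-- The cylinder of `J` acting on the right preserves the entry, since every `K ++ J` ends in `J`;
acting on the left it kills it, since no `K ++ I` ends in `J` when the words are incomparable. -/
theorem coeff_eq_zero_of_commute_cylinder (hω : ∀ i, 0 ≤ ω i) (hs : HasSum ω 1)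
    {κ : Ultrafilter ℕ} (hκ : (κ : Filter ℕ) ≤ cofinite) {x : FullFock H →L[ℂ] FullFock H}
    (hx : x ∈ poissonBoundary e ω) {I J : List Θ}
    (hc : choiEffros e ω κ x (cylinder e ω κ J) = choiEffros e ω κ (cylinder e ω κ J) x)
    (h : ¬ I <:+ J) (h' : ¬ J <:+ I) : coeff e I J x = 0 := by
  have h1 : coeff e I J (choiEffros e ω κ x (cylinder e ω κ J)) = coeff e I J x := by
    rw [choiEffros_cylinder_right e hω hs hκ,
      coeff_poissonProjection_of_append e hω hs hκ (c := 1) (y := x) 0 fun K _ => ?_,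
      poissonProjection_eq_self e hω hs hκ hx, one_mul]
    rw [coeff_mul_of_mem_diagonalOps e x (suffixProj_mem_diagonalOps e J),
      coeff_suffixProj_of_suffix e (List.suffix_append K J)]
  have h2 : coeff e I J (choiEffros e ω κ (cylinder e ω κ J) x) = 0 := by
    rw [choiEffros_cylinder_left e hω hs hκ,
      coeff_poissonProjection_of_append e hω hs hκ (c := 0) (y := x) 0 fun K _ => ?_, zero_mul]
    rw [coeff_of_mem_diagonalOps_mul e (suffixProj_mem_diagonalOps e J),
      coeff_suffixProj_of_not_suffix e fun hJ => ?_]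
    rcases List.suffix_or_suffix_of_suffix hJ (List.suffix_append K I) with h3 | h3
    · exact h' h3
    · exact h h3
  rw [← h1, hc, h2]

theorem mem_diagonalOps_of_commute_cylinder [Nontrivial Θ] (hpos : ∀ i, 0 < ω i)
    (hs : HasSum ω 1) {κ : Ultrafilter ℕ} (hκ : (κ : Filter ℕ) ≤ cofinite)
    {x : FullFock H →L[ℂ] FullFock H} (hx : x ∈ poissonBoundary e ω)
    (hc : ∀ L, choiEffros e ω κ x (cylinder e ω κ L) = choiEffros e ω κ (cylinder e ω κ L) x) :
    x ∈ diagonalOps e := by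
  have h0 : ∀ I J, ¬ I <:+ J → ¬ J <:+ I → coeff e I J x = 0 := fun I J =>
    coeff_eq_zero_of_commute_cylinder e (fun i => (hpos i).le) hs hκ hx (hc J)
  have hsuf : ∀ {C K I : List Θ}, K ++ I <:+ K ++ (C ++ I) → K <:+ K ++ C := by
    rintro C K I ⟨D, hD⟩
    exact ⟨D, List.append_cancel_right (by simpa using hD)⟩
  have hnot : ∀ {C K I : List Θ}, C ≠ [] → ¬ K ++ (C ++ I) <:+ K ++ I := by
    intro C K I hC h
    have := h.length_le
    have := List.length_pos_iff.2 hC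
    simp only [List.length_append] at *
    omega
  rw [mem_diagonalOps_iff]
  intro I J hIJ
  by_cases h1 : I <:+ J
  · obtain ⟨C, rfl⟩ := h1
    have hC : C ≠ [] := by
      rintro rfl
      exact hIJ rfl
    -- A nonzero entry at an extension forces the extended words to be comparable too; by length
    -- only `K ++ I` can be the suffix, so `K` is a tail of `…CCC`.
    refine coeff_eq_zero_of_forall_exists e hpos hs hx fun K K' hlen hK hK' => ?_
    refine List.eq_of_suffix_append hC hlen (hsuf (I := I) ?_) (hsuf (I := I) ?_)
    · by_contra h2
      exact hK (h0 _ _ h2 (hnot hC))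
    · by_contra h2
      exact hK' (h0 _ _ h2 (hnot hC))
  · by_cases h2 : J <:+ I
    · obtain ⟨C, rfl⟩ := h2
      have hC : C ≠ [] := by
        rintro rfl
        exact hIJ rfl
      refine coeff_eq_zero_of_forall_exists e hpos hs hx fun K K' hlen hK hK' => ?_
      refine List.eq_of_suffix_append hC hlen (hsuf (I := J) ?_) (hsuf (I := J) ?_)
      · by_contra h2
        exact hK (h0 _ _ (hnot hC) h2)
      · by_contra h2
        exact hK' (h0 _ _ (hnot hC) h2)
    · exact h0 I J h1 h2

end Masa

/-! ### Closedness in the `σ`-weak topology. -/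

section Closed

variable {H : Type u} [NormedAddCommGroup H] [InnerProductSpace ℂ H]
  {Θ : Type v} (e : HilbertBasis Θ ℂ H) {ω : Θ → ℝ}

theorem continuous_sigmaWeak_tsum {K : Type u} [NormedAddCommGroup K] [InnerProductSpace ℂ K]
    (ξ η : lp (fun _ : ℕ => K) 2) :
    Continuous[sigmaWeak K, inferInstance] fun x : K →L[ℂ] K => ∑' n, ⟪ξ n, x (η n)⟫_ℂ := by
  have h : Continuous[sigmaWeak K, inferInstance]
      fun (x : K →L[ℂ] K) (p : lp (fun _ : ℕ => K) 2 × lp (fun _ : ℕ => K) 2) =>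
        ∑' n, ⟪p.1 n, x (p.2 n)⟫_ℂ := continuous_induced_dom
  exact @Continuous.comp _ _ _ (sigmaWeak K) _ _ _ _ (continuous_apply (ξ, η)) h

theorem continuous_sigmaWeak_inner {K : Type u} [NormedAddCommGroup K] [InnerProductSpace ℂ K]
    (ξ η : K) : Continuous[sigmaWeak K, inferInstance] fun x : K →L[ℂ] K => ⟪ξ, x η⟫_ℂ := by
  have h := continuous_sigmaWeak_tsum (lp.single 2 0 ξ : lp (fun _ : ℕ => K) 2)
    (lp.single 2 0 η : lp (fun _ : ℕ => K) 2)
  convert h using 2 with x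
  rw [tsum_eq_single 0 fun n hn => by rw [lp.single_apply_ne 2 _ _ hn, inner_zero_left],
    lp.single_apply_self, lp.single_apply_self]

/-- The values `√(ω i) ξ i` along an enumeration `f` form a square summable sequence. -/
theorem memℓp_extend_sqrt_smul {K : Type u} [NormedAddCommGroup K] [InnerProductSpace ℂ K]
    (hω : ∀ i, 0 ≤ ω i) (hs : Summable ω) {f : Θ → ℕ} (hf : f.Injective) {ξ : Θ → K}
    (hξ : ∀ i, ‖ξ i‖ = 1) :
    Memℓp (E := fun _ : ℕ => K)
      (Function.extend f (fun i => ((√(ω i) : ℝ) : ℂ) • ξ i) 0) 2 := by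
  have h2 : (2 : ENNReal).toReal = 2 := by norm_num
  refine memℓp_gen ?_
  have h := (hasSum_extend_zero hf).2 hs.hasSum
  refine h.summable.congr fun n => ?_
  rw [h2]
  by_cases hn : ∃ i, f i = n
  · obtain ⟨i, rfl⟩ := hn
    rw [hf.extend_apply, hf.extend_apply, norm_smul, hξ, mul_one, Complex.norm_real,
      Real.norm_of_nonneg (Real.sqrt_nonneg _)]
    norm_cast
    exact (Real.sq_sqrt (hω i)).symm
  · rw [Function.extend_apply' _ _ _ hn, Function.extend_apply' _ _ _ hn]
    simp

/-- Splitting `ω i = √(ω i) * √(ω i)` between the two vectors and enumerating the countable `Θ`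
gives a defining functional of the topology. Each coefficient of the Markov operator has this form.
-/
theorem continuous_sigmaWeak_tsum_weights {K : Type u} [NormedAddCommGroup K]
    [InnerProductSpace ℂ K] [Countable Θ] (hω : ∀ i, 0 ≤ ω i) (hs : Summable ω) {ξ η : Θ → K}
    (hξ : ∀ i, ‖ξ i‖ = 1) (hη : ∀ i, ‖η i‖ = 1) :
    Continuous[sigmaWeak K, inferInstance] fun x : K →L[ℂ] K =>
      ∑' i, (ω i : ℂ) * ⟪ξ i, x (η i)⟫_ℂ := by
  obtain ⟨f, hf⟩ := exists_injective_nat Θ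
  have h := continuous_sigmaWeak_tsum (⟨_, memℓp_extend_sqrt_smul hω hs hf hξ⟩)
    ⟨_, memℓp_extend_sqrt_smul hω hs hf hη⟩
  convert h using 2 with x
  rw [← tsum_extend_zero hf]
  refine tsum_congr fun n => ?_
  by_cases hn : ∃ i, f i = n
  · obtain ⟨i, rfl⟩ := hn
    simp only [hf.extend_apply, map_smul, inner_smul_left, inner_smul_right, Complex.conj_ofReal]
    rw [← mul_assoc, ← Complex.ofReal_mul, Real.mul_self_sqrt (hω i)]
  · simp only [Function.extend_apply' _ _ _ hn]
    simp

theorem isClosed_sigmaWeak_diagonalOps : IsClosed[sigmaWeak (FullFock H)] (diagonalOps e) := by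
  let _ := sigmaWeak (FullFock H)
  have h : diagonalOps e = ⋂ (I : List Θ) (J : List Θ) (_ : I ≠ J),
      {x | ⟪fockBasis e I, x (fockBasis e J)⟫_ℂ = 0} := by
    ext x
    simp [diagonalOps]
  rw [h]
  exact isClosed_iInter fun I => isClosed_iInter fun J => isClosed_iInter fun _ =>
    isClosed_eq (continuous_sigmaWeak_inner _ _) continuous_const

theorem isClosed_sigmaWeak_poissonBoundary [Countable Θ] (hω : ∀ i, 0 ≤ ω i) (hs : HasSum ω 1) :
    IsClosed[sigmaWeak (FullFock H)] (poissonBoundary e ω) := by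
  let _ := sigmaWeak (FullFock H)
  have h : poissonBoundary e ω = ⋂ (I : List Θ) (J : List Θ),
      {x | ∑' i, (ω i : ℂ) * ⟪fockBasis e (i :: I), x (fockBasis e (i :: J))⟫_ℂ =
        ⟪fockBasis e I, x (fockBasis e J)⟫_ℂ} := by
    ext x
    simp only [Set.mem_iInter, Set.mem_ofPred_eq]
    constructor
    · intro hx I J
      exact ((mem_poissonBoundary_iff_hasSum e hω hs x).1 hx I J).tsum_eq
    · intro hx
      refine ext_coeff e fun I J => ?_
      rw [← (hasSum_coeff_markov e hω hs x I J).tsum_eq]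
      exact hx I J
  rw [h]
  exact isClosed_iInter fun I => isClosed_iInter fun J => isClosed_eq
    (continuous_sigmaWeak_tsum_weights hω hs.summable (fun i => norm_fockBasis e _)
      fun i => norm_fockBasis e _) (continuous_sigmaWeak_inner _ _)

end Closed

/-! ### The masa property. -/

section Main

variable {H : Type u} [NormedAddCommGroup H] [InnerProductSpace ℂ H]
  {Θ : Type v} (e : HilbertBasis Θ ℂ H) {ω : Θ → ℝ}

theorem choiEffros_comm (κ : Ultrafilter ℕ) {x y : FullFock H →L[ℂ] FullFock H}
    (hx : x ∈ diagonalOps e) (hy : y ∈ diagonalOps e) :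
    choiEffros e ω κ x y = choiEffros e ω κ y x := by
  rw [choiEffros, choiEffros, mul_comm_of_mem_diagonalOps e hx hy]

theorem add_mem_poissonBoundary (hω : ∀ i, 0 ≤ ω i) (hs : HasSum ω 1)
    {x y : FullFock H →L[ℂ] FullFock H} (hx : x ∈ poissonBoundary e ω)
    (hy : y ∈ poissonBoundary e ω) : x + y ∈ poissonBoundary e ω := by
  have h : markov e ω (x + y) = markov e ω x + markov e ω y := (markovLinear e hω hs).map_add x y
  rw [show markov e ω x = x from hx, show markov e ω y = y from hy] at h
  exact h

theorem smul_mem_poissonBoundary (hω : ∀ i, 0 ≤ ω i) (hs : HasSum ω 1) (c : ℂ)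
    {x : FullFock H →L[ℂ] FullFock H} (hx : x ∈ poissonBoundary e ω) :
    c • x ∈ poissonBoundary e ω := by
  have h : markov e ω (c • x) = c • markov e ω x := (markovLinear e hω hs).map_smul c x
  rw [show markov e ω x = x from hx] at h
  exact h

theorem star_mem_poissonBoundary (hω : ∀ i, 0 ≤ ω i) (hs : HasSum ω 1)
    {x : FullFock H →L[ℂ] FullFock H} (hx : x ∈ poissonBoundary e ω) :
    star x ∈ poissonBoundary e ω := by
  have h := markov_star e hω hs x
  rw [show markov e ω x = x from hx] at h
  exact h

theorem isAbelianVNSubalgebra_diagonal [Countable Θ] (hω : ∀ i, 0 ≤ ω i) (hs : HasSum ω 1)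
    {κ : Ultrafilter ℕ} (hκ : (κ : Filter ℕ) ≤ cofinite) :
    IsAbelianVNSubalgebra (poissonBoundary e ω) (choiEffros e ω κ)
      (diagonalOps e ∩ poissonBoundary e ω) where
  subset := Set.inter_subset_right
  one_mem := ⟨fun _ _ h => coeff_one_of_ne e h, one_mem_poissonBoundary e hω hs⟩
  add_mem x hx y hy := by
    refine ⟨fun I J h => ?_, ?_⟩
    · change coeff e I J (x + y) = 0
      rw [map_add, (mem_diagonalOps_iff e x).1 hx.1 I J h, (mem_diagonalOps_iff e y).1 hy.1 I J h,
        add_zero]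
    · exact add_mem_poissonBoundary e hω hs hx.2 hy.2
  smul_mem c x hx := by
    refine ⟨fun I J h => ?_, ?_⟩
    · change coeff e I J (c • x) = 0
      rw [map_smul, (mem_diagonalOps_iff e x).1 hx.1 I J h, smul_zero]
    · exact smul_mem_poissonBoundary e hω hs c hx.2
  star_mem x hx := ⟨star_mem_diagonalOps e hx.1, star_mem_poissonBoundary e hω hs hx.2⟩
  mul_mem x hx y hy := ⟨poissonProjection_mem_diagonalOps e hω hs hκ
    (mul_mem_diagonalOps e hx.1 hy.1), poissonProjection_mem e hω hs hκ _⟩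
  mul_comm x hx y hy := choiEffros_comm e κ hx.1 hy.1
  isClosed := by
    let _ := sigmaWeak (FullFock H)
    exact IsClosed.inter (isClosed_sigmaWeak_diagonalOps e)
      (isClosed_sigmaWeak_poissonBoundary e hω hs)

theorem relativeCommutant_diagonal [Nontrivial Θ] (hpos : ∀ i, 0 < ω i) (hs : HasSum ω 1)
    {κ : Ultrafilter ℕ} (hκ : (κ : Filter ℕ) ≤ cofinite) :
    relativeCommutant (poissonBoundary e ω) (choiEffros e ω κ)
      (diagonalOps e ∩ poissonBoundary e ω) = diagonalOps e ∩ poissonBoundary e ω := by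
  ext x
  constructor
  · rintro ⟨hx, hc⟩
    exact ⟨mem_diagonalOps_of_commute_cylinder e hpos hs hκ hx fun L =>
      hc _ (cylinder_mem e (fun i => (hpos i).le) hs hκ L), hx⟩
  · exact fun hx => ⟨hx.2, fun d hd => choiEffros_comm e κ hx.1 hd.1⟩

theorem isMasa_diagonal [Countable Θ] [Nontrivial Θ] (hpos : ∀ i, 0 < ω i) (hs : HasSum ω 1)
    {κ : Ultrafilter ℕ} (hκ : (κ : Filter ℕ) ≤ cofinite) :
    IsMasa (poissonBoundary e ω) (choiEffros e ω κ) (diagonalOps e ∩ poissonBoundary e ω) where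
  abelian := isAbelianVNSubalgebra_diagonal e (fun i => (hpos i).le) hs hκ
  maximal B hB hAB := by
    refine Set.Subset.antisymm (fun x hx => ?_) hAB
    -- An abelian algebra containing the diagonal one commutes with it, so it lies in the relative
    -- commutant.
    rw [← relativeCommutant_diagonal e hpos hs hκ]
    exact ⟨hB.subset hx, fun d hd => hB.mul_comm x hx d (hAB hd)⟩
  relativeCommutant_eq := relativeCommutant_diagonal e hpos hs hκ

/-! ### Diffuseness. -/

theorem eq_of_coeff_self_eq (hω : ∀ i, 0 ≤ ω i) (hs : HasSum ω 1)
    {x y : FullFock H →L[ℂ] FullFock H} (hx : x ∈ diagonalOps e ∩ poissonBoundary e ω)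
    (hy : y ∈ diagonalOps e ∩ poissonBoundary e ω) (m : ℕ)
    (h : ∀ I : List Θ, m ≤ I.length → coeff e I I x = coeff e I I y) : x = y := by
  -- Any free ultrafilter serves: each such `E` fixes both harmonic operators.
  have hκ : ((hyperfilter ℕ : Ultrafilter ℕ) : Filter ℕ) ≤ cofinite := hyperfilter_le_cofinite
  rw [← poissonProjection_eq_self e hω hs hκ hx.2, ← poissonProjection_eq_self e hω hs hκ hy.2]
  refine poissonProjection_congr e hω hs hκ m fun I J hI _ => ?_
  by_cases hIJ : I = J
  · subst hIJ
    exact h I hI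
  · rw [(mem_diagonalOps_iff e x).1 hx.1 I J hIJ, (mem_diagonalOps_iff e y).1 hy.1 I J hIJ]

theorem coeff_cylinder_mul (hω : ∀ i, 0 ≤ ω i) (hs : HasSum ω 1) {κ : Ultrafilter ℕ}
    (hκ : (κ : Filter ℕ) ≤ cofinite) {q : FullFock H →L[ℂ] FullFock H}
    (hq : q ∈ poissonBoundary e ω) {L I : List Θ} (h : L.length ≤ I.length) (J : List Θ) :
    coeff e I J (choiEffros e ω κ (cylinder e ω κ L) q) =
      coeff e I I (suffixProj e L) * coeff e I J q := by
  rw [choiEffros_cylinder_left e hω hs hκ, coeff_poissonProjection_suffixProj_mul e hω hs hκ h,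
    poissonProjection_eq_self e hω hs hκ hq]

theorem cylinder_mul_mem (hω : ∀ i, 0 ≤ ω i) (hs : HasSum ω 1) {κ : Ultrafilter ℕ}
    (hκ : (κ : Filter ℕ) ≤ cofinite) {q : FullFock H →L[ℂ] FullFock H}
    (hq : q ∈ diagonalOps e) (L : List Θ) :
    choiEffros e ω κ (cylinder e ω κ L) q ∈ diagonalOps e ∩ poissonBoundary e ω :=
  ⟨poissonProjection_mem_diagonalOps e hω hs hκ
    (mul_mem_diagonalOps e (cylinder_mem e hω hs hκ L).1 hq), poissonProjection_mem e hω hs hκ _⟩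

/-- If an operator has the same boundary values as the product of a cylinder projection and the
square of a projection `q`, then its image under the projection onto the harmonic operators is the
Choi-Effros product of the two projections. -/
theorem poissonProjection_eq_cylinder_mul (hω : ∀ i, 0 ≤ ω i) (hs : HasSum ω 1)
    {κ : Ultrafilter ℕ} (hκ : (κ : Filter ℕ) ≤ cofinite) {q y : FullFock H →L[ℂ] FullFock H}
    (hq : IsProjectionIn (choiEffros e ω κ) (diagonalOps e ∩ poissonBoundary e ω) q)
    (hy : y ∈ diagonalOps e) (L : List Θ)
    (h : ∀ I, L.length ≤ I.length →
      coeff e I I y = coeff e I I (suffixProj e L) * (coeff e I I q * coeff e I I q)) :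
    poissonProjection e ω κ y = choiEffros e ω κ (cylinder e ω κ L) q := by
  have h1 : poissonProjection e ω κ y = poissonProjection e ω κ (suffixProj e L * (q * q)) := by
    have hd := mul_mem_diagonalOps e (suffixProj_mem_diagonalOps e L)
      (mul_mem_diagonalOps e hq.1.1 hq.1.1)
    refine poissonProjection_congr e hω hs hκ L.length fun I J hI _ => ?_
    by_cases hIJ : I = J
    · subst hIJ
      rw [h I hI, coeff_of_mem_diagonalOps_mul e (suffixProj_mem_diagonalOps e L),
        coeff_of_mem_diagonalOps_mul e hq.1.1]
    · rw [(mem_diagonalOps_iff e y).1 hy I J hIJ, (mem_diagonalOps_iff e _).1 hd I J hIJ]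
  rw [h1]
  refine eq_of_coeff_self_eq e hω hs
    ⟨poissonProjection_mem_diagonalOps e hω hs hκ (mul_mem_diagonalOps e
      (suffixProj_mem_diagonalOps e L) (mul_mem_diagonalOps e hq.1.1 hq.1.1)),
      poissonProjection_mem e hω hs hκ _⟩
    (cylinder_mul_mem e hω hs hκ hq.1.1 L) L.length fun I hI => ?_
  rw [coeff_poissonProjection_suffixProj_mul e hω hs hκ hI,
    coeff_cylinder_mul e hω hs hκ hq.1.2 hI, show poissonProjection e ω κ (q * q) = q from hq.2.2]

theorem coeff_suffixProj_mul_self (L I : List Θ) :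
    coeff e I I (suffixProj e L) * coeff e I I (suffixProj e L) =
      coeff e I I (suffixProj e L) := by
  by_cases h : L <:+ I
  · rw [coeff_suffixProj_of_suffix e h, one_mul]
  · rw [coeff_suffixProj_of_not_suffix e h, zero_mul]

/-- The cut-down of `q` lies below `q`. General associativity of the Choi-Effros product is bypassed
by comparing diagonal entries at long words. -/
theorem cylinder_mul_mul (hω : ∀ i, 0 ≤ ω i) (hs : HasSum ω 1) {κ : Ultrafilter ℕ}
    (hκ : (κ : Filter ℕ) ≤ cofinite) {q : FullFock H →L[ℂ] FullFock H}
    (hq : IsProjectionIn (choiEffros e ω κ) (diagonalOps e ∩ poissonBoundary e ω) q)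
    (L : List Θ) :
    choiEffros e ω κ (choiEffros e ω κ (cylinder e ω κ L) q) q =
      choiEffros e ω κ (cylinder e ω κ L) q := by
  have hp := cylinder_mul_mem e hω hs hκ hq.1.1 L
  refine poissonProjection_eq_cylinder_mul e hω hs hκ hq
    (mul_mem_diagonalOps e hp.1 hq.1.1) L fun I hI => ?_
  rw [coeff_of_mem_diagonalOps_mul e hp.1, coeff_cylinder_mul e hω hs hκ hq.1.2 hI, mul_assoc]

theorem isProjectionIn_cylinder_mul (hω : ∀ i, 0 ≤ ω i) (hs : HasSum ω 1) {κ : Ultrafilter ℕ}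
    (hκ : (κ : Filter ℕ) ≤ cofinite) {q : FullFock H →L[ℂ] FullFock H}
    (hq : IsProjectionIn (choiEffros e ω κ) (diagonalOps e ∩ poissonBoundary e ω) q)
    (L : List Θ) :
    IsProjectionIn (choiEffros e ω κ) (diagonalOps e ∩ poissonBoundary e ω)
      (choiEffros e ω κ (cylinder e ω κ L) q) := by
  have hp := cylinder_mul_mem e hω hs hκ hq.1.1 L
  refine ⟨hp, ?_, ?_⟩
  · rw [choiEffros_cylinder_left e hω hs hκ, ← poissonProjection_star e hω hs, star_mul,
      star_suffixProj, hq.2.1, mul_comm_of_mem_diagonalOps e hq.1.1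
        (suffixProj_mem_diagonalOps e L)]
  · refine poissonProjection_eq_cylinder_mul e hω hs hκ hq
      (mul_mem_diagonalOps e hp.1 hp.1) L fun I hI => ?_
    rw [coeff_of_mem_diagonalOps_mul e hp.1, coeff_cylinder_mul e hω hs hκ hq.1.2 hI,
      mul_mul_mul_comm, coeff_suffixProj_mul_self]

theorem isDiffuse_diagonal [Nontrivial Θ] (hpos : ∀ i, 0 < ω i) (hs : HasSum ω 1)
    {κ : Ultrafilter ℕ} (hκ : (κ : Filter ℕ) ≤ cofinite) :
    IsDiffuse (choiEffros e ω κ) (diagonalOps e ∩ poissonBoundary e ω) := by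
  rintro q ⟨hq, hq0, hmin⟩
  have hω : ∀ i, 0 ≤ ω i := fun i => (hpos i).le
  -- Were `q` nonzero at two words `L ≠ L'` of equal length, its cut by the cylinder of `L` would
  -- keep the entry at `L` and lose the one at `L'`, so it would be neither `0` nor `q`.
  have hsupp : ∀ L L' : List Θ, L.length = L'.length → coeff e L L q ≠ 0 →
      coeff e L' L' q ≠ 0 → L = L' := by
    intro L L' hlen hL hL'
    by_contra hne
    have hself := coeff_cylinder_mul e hω hs hκ hq.1.2 (le_refl L.length) L
    rw [coeff_suffixProj_of_suffix e List.suffix_rfl, one_mul] at hself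
    have hother := coeff_cylinder_mul e hω hs hκ hq.1.2 hlen.le L'
    rw [coeff_suffixProj_of_not_suffix e fun h => hne (h.eq_of_length hlen), zero_mul] at hother
    rcases hmin _ (isProjectionIn_cylinder_mul e hω hs hκ hq L)
      (cylinder_mul_mul e hω hs hκ hq L) with h | h
    · rw [h, map_zero] at hself
      exact hL hself.symm
    · rw [h] at hother
      exact hL' hother
  refine hq0 (ext_coeff e fun I J => ?_)
  rw [map_zero]
  by_cases h : I = J
  · subst h
    exact coeff_eq_zero_of_forall_exists e hpos hs hq.1.2 fun K K' hlen hK hK' =>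
      List.append_cancel_right (hsupp _ _ (by simp [hlen]) hK hK')
  · exact (mem_diagonalOps_iff e q).1 hq.1.1 I J h

end Main

end FockBoundary

end

theorem theorem5 {H : Type u} [NormedAddCommGroup H] [InnerProductSpace ℂ H]
    {Θ : Type v} [Countable Θ] [Nontrivial Θ] (e : HilbertBasis Θ ℂ H)
    (ω : Θ → ℝ) (hpos : ∀ i, 0 < ω i) (hsum : HasSum ω 1)
    (κ : Ultrafilter ℕ) (hκ : (κ : Filter ℕ) ≤ Filter.cofinite) :
    IsMasa (poissonBoundary e ω) (choiEffros e ω κ)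
        (diagonalOps e ∩ poissonBoundary e ω) ∧
      IsDiffuse (choiEffros e ω κ) (diagonalOps e ∩ poissonBoundary e ω) :=
  ⟨isMasa_diagonal e hpos hsum hκ, isDiffuse_diagonal e hpos hsum hκ⟩
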